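/- Let $\alpha>0$, $\beta\in(0,1)$, $k\in(0,1)$ and $p\in(0,1)$. Consider a single TCP Compound connection with fixed round trip time (RTT), no queueing and no bound on the window, in which every packet is lost independently of all others with probability $p$. Its integer-valued window size process $\{W_n(p)\}_{n\ge 0}$ ($n$ counts RTTs) evolves as follows. The initial window $W_0(p)\ge 1$ is random and independent of the packet losses. In the RTT from $n$ to $n+1$, $W_n(p)$ packets are sent, and $$W_{n+1}(p)=\begin{cases}\big\lfloor W_n(p)+1+(\alpha W_n(p)^k-1)^+\big\rfloor & \text{if none of them is lost},\\ \max\{1,\lfloor(1-\beta)W_n(p)\rfloor\} & \text{if at least one of them is lost.}\end{cases}$$ Let $T_0=0$ (the time origin is taken to be a loss epoch) and let $T_{j+1}$ be the end of the first RTT, among those starting at time $T_j$ or later, in which a loss occurs. Let $V_j(p)=W_{T_j}(p)$ be the window size at the $j$-th loss epoch, just after the loss, and let $G^p_{V_j(p)}=T_{j+1}-T_j$ be the time, in RTTs, between the $j$-th and the $(j+1)$-st loss. A stationary version of a process $\{X_j\}_{j\ge0}$ defined from $\{W_n(p)\}$ is obtained from a law of $W_0(p)$ on $\{1,2,\dots\}$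 under which $\{X_{j+1}\}_{j\ge0}$ has the same law as $\{X_j\}_{j\ge0}$; the law of $X_0$ is then called a stationary distribution of the process. Then: 1. $\{V_j(p)\}$ has a unique stationary distribution. Moreover, every law $\mu$ on $\{1,2,\dots\}$ such that $V_1(p)\sim\mu$ whenever $V_0(p)\sim\mu$ is a stationary distribution of $\{V_j(p)\}$ (and hence equals the unique one). 2. $\{G^p_{V_j(p)}\}$ has a unique stationary distribution, and all stationary versions of $\{G^p_{V_j(p)}\}$ have the same law as processes. 3. If $V(p)$ has the stationary distribution of $\{V_j(p)\}$, then $E[V(p)^\eta]<\infty$ for every real $\eta\ge1$. -/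

import Mathlib

open MeasureTheory ProbabilityTheory

namespace TCPCompound

noncomputable section

/-- A scenario: the window size at time `0`, and for every pair `(n, i)` the information whether
the `i`-th packet sent in the `n`-th round trip time (RTT) is lost (`true`) or not (`false`). -/
abbrev Scenario : Type := ℕ × (ℕ × ℕ → Bool)

/-- Window update in an RTT without loss and without queueing, starting from window `w`:
the loss-based component grows by `1`, the delay-based component by `(α w ^ k - 1)⁺`;
windows are integers, so the integer part is taken. -/
def increase (α k : ℝ) (w : ℕ) : ℕ :=
  ⌊(w : ℝ) + (1 + max (α * (w : ℝ) ^ k - 1) 0)⌋₊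

/-- Window update in an RTT with a loss: both components are multiplied by `1 - β`; the integer
part is taken, and the window never drops below one packet. -/
def decrease (β : ℝ) (w : ℕ) : ℕ :=
  max 1 ⌊(1 - β) * (w : ℝ)⌋₊

open scoped Classical in
/-- The window size `W n` at time `n`, in multiples of the RTT. In the RTT from time `n` to time
`n + 1` the `W n` packets `0, …, W n - 1` are sent; the window is decreased if at least one of
them is lost, and increased otherwise. -/
def window (α β k : ℝ) (ω : Scenario) : ℕ → ℕ
  | 0 => ω.1
  | n + 1 =>
    if ∃ i < window α β k ω n, ω.2 (n, i) = true then decrease β (window α β k ω n)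
    else increase α k (window α β k ω n)

/-- At least one of the packets sent between time `n` and time `n + 1` is lost. -/
def HasLoss (α β k : ℝ) (ω : Scenario) (n : ℕ) : Prop :=
  ∃ i < window α β k ω n, ω.2 (n, i) = true

/-- The loss epochs. The time origin is the loss epoch number `0`, and the next loss epoch after
time `t` is the end of the first RTT starting at time `t` or later in which a loss occurs. -/
def lossEpoch (α β k : ℝ) (ω : Scenario) : ℕ → ℕ
  | 0 => 0
  | j + 1 => sInf {n | lossEpoch α β k ω j ≤ n ∧ HasLoss α β k ω n} + 1

/-- `V j`: the window size at the `j`-th loss epoch, just after the loss. -/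
def lossWindow (α β k : ℝ) (j : ℕ) (ω : Scenario) : ℕ :=
  window α β k ω (lossEpoch α β k ω j)

/-- `G_{V j}`: the time, in multiples of the RTT, between the `j`-th and the `(j+1)`-st loss. -/
def interLossTime (α β k : ℝ) (j : ℕ) (ω : Scenario) : ℕ :=
  lossEpoch α β k ω (j + 1) - lossEpoch α β k ω j

/-- The law of the scenario: the initial window has law `μ`, and, independently of it, packets are
lost independently of each other with probability `p`. -/
def scenarioLaw (p : unitInterval) (μ : Measure ℕ) : Measure Scenario :=
  μ.prod (Measure.infinitePi fun _ : ℕ × ℕ => bernoulliMeasure true false p)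

/-- Laws of the initial window: probability measures on the positive integers. -/
structure IsInitialLaw (μ : Measure ℕ) : Prop where
  isProbabilityMeasure : IsProbabilityMeasure μ
  ae_pos : ∀ᵐ w ∂μ, 1 ≤ w

/-- `Q` is the law of a stationary version of the process `X`: for some law of the initial window,
`X` has law `Q`, and this law is invariant under the time shift. -/
def IsStationaryLaw (p : unitInterval) (X : ℕ → Scenario → ℕ) (Q : Measure (ℕ → ℕ)) : Prop :=
  ∃ μ : Measure ℕ, IsInitialLaw μ ∧ (scenarioLaw p μ).map (fun ω j => X j ω) = Q ∧
    Q.map (fun x j => x (j + 1)) = Q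

/-- `ν` is a stationary distribution of the process `X`: it is the distribution of each term of
a stationary version of `X`. -/
def IsStationaryDistribution (p : unitInterval) (X : ℕ → Scenario → ℕ) (ν : Measure ℕ) : Prop :=
  ∃ Q : Measure (ℕ → ℕ), IsStationaryLaw p X Q ∧ Q.map (fun x => x 0) = ν

end

end TCPCompound

/-! ### Markov chains on `ℕ` with geometric drift and an accessible atom -/

namespace MarkovChain

open Filter Topology
open scoped ENNReal NNReal

/-! Losses in different RTTs are independent, so the windows at loss epochs form a Markov chain,
with kernel `lossKernel`. Seen from its first loss epoch, a scenario with initial law `μ` is again a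
scenario, with initial law `μ.bind (lossKernel α β k p)` (`map_lossShift`). Everything thus reduces
to ergodicity of this chain.

Two properties give it. Drift (`exists_drift`): an immediate loss multiplies the window `v` by about
`1 - β`, while a later loss requires that some grown window `w` first passes without loss, which has
probability `keep p ^ w`. Exponential beats polynomial, so later losses add only a bounded amount,
and `E[v'^η] ≤ γ v^η + K` with `γ < 1`. Accessibility (`le_lossKernel_pow_one`): `n` immediate
losses in a row bring every window of size at most `n` down to `1`, with probability at least `(1 -
keep p) ^ n`.

A Harris-type argument (`exists_geometric_contraction`) then shows that some power of the kernel
contracts a weighted oscillation, so the chain forgets its start; tightness supplies a limit `π`,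
which is invariant (`exists_invariant_and_tendsto`).

A stationary law of `V` is an invariant law of the kernel, hence `π`. The initial law cannot be read
off directly from the inter-loss times. But if they are stationary from `μ`, they have the same law
when started from `μ` moved by any number of kernel steps. Along the convergence to `π` that law is
the one started from `π`. Moments of `π` come from uniform moment bounds for the chain started at
`1`, by Fatou. -/

theorem isMarkovKernel_pow (κ : Kernel ℕ ℕ) [IsMarkovKernel κ] (n : ℕ) :
    IsMarkovKernel (κ ^ n) := by
  induction n with
  | zero => exact inferInstanceAs (IsMarkovKernel (Kernel.id))
  | succ n ih => rw [pow_succ]; exact inferInstanceAs (IsMarkovKernel ((κ ^ n) ∘ₖ κ))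

theorem lintegral_mul (κ η : Kernel ℕ ℕ) (x : ℕ) (g : ℕ → ℝ≥0∞) :
    ∫⁻ z, g z ∂(κ * η) x = ∫⁻ y, ∫⁻ z, g z ∂κ y ∂η x :=
  Kernel.lintegral_comp κ η x (measurable_of_countable g)

theorem integrable_of_abs_le_one {μ : Measure ℕ} [IsFiniteMeasure μ] {φ : ℕ → ℝ}
    (h : ∀ x, |φ x| ≤ 1) : Integrable φ μ :=
  Integrable.of_bound (measurable_of_countable φ).aestronglyMeasurable 1 (ae_of_all _ h)

theorem abs_integral_le_one {μ : Measure ℕ} [IsProbabilityMeasure μ] {φ : ℕ → ℝ}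
    (h : ∀ x, |φ x| ≤ 1) : |∫ x, φ x ∂μ| ≤ 1 := by
  simpa using norm_integral_le_of_norm_le_const (μ := μ) (f := φ) (ae_of_all _ h)

theorem integral_bind {μ : Measure ℕ} [IsProbabilityMeasure μ] (κ : Kernel ℕ ℕ)
    [IsMarkovKernel κ] {φ : ℕ → ℝ} (h : ∀ x, |φ x| ≤ 1) :
    ∫ z, φ z ∂(μ.bind κ) = ∫ y, ∫ z, φ z ∂κ y ∂μ := by
  have := Kernel.integral_comp (η := κ) (κ := Kernel.const Unit μ) (a := ()) (f := φ)
    (integrable_of_abs_le_one h)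
  rwa [Kernel.comp_apply, Kernel.const_apply] at this

theorem integral_mul (κ η : Kernel ℕ ℕ) [IsMarkovKernel κ] [IsMarkovKernel η] (x : ℕ)
    {φ : ℕ → ℝ} (h : ∀ x, |φ x| ≤ 1) :
    ∫ z, φ z ∂(κ * η) x = ∫ y, ∫ z, φ z ∂κ y ∂η x := by
  have : IsMarkovKernel (κ * η) := inferInstanceAs (IsMarkovKernel (κ ∘ₖ η))
  exact Kernel.integral_comp (integrable_of_abs_le_one h)

theorem bind_mul (μ : Measure ℕ) (κ η : Kernel ℕ ℕ) :
    μ.bind (κ * η : Kernel ℕ ℕ) = (μ.bind η).bind κ :=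
  Measure.comp_assoc.symm

theorem bind_one (μ : Measure ℕ) : μ.bind (1 : Kernel ℕ ℕ) = μ :=
  Measure.id_comp

theorem lintegral_one (x : ℕ) (g : ℕ → ℝ≥0∞) : ∫⁻ y, g y ∂(1 : Kernel ℕ ℕ) x = g x := by
  change ∫⁻ y, g y ∂(Kernel.id (α := ℕ)) x = g x
  rw [Kernel.id_apply, lintegral_dirac]

theorem measure_eq_of_integral_eq {μ ν : Measure ℕ} [IsProbabilityMeasure μ]
    [IsProbabilityMeasure ν] (h : ∀ φ : ℕ → ℝ, (∀ x, |φ x| ≤ 1) → ∫ x, φ x ∂μ = ∫ x, φ x ∂ν) :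
    μ = ν := by
  ext s hs
  have := h (s.indicator 1) (fun x => by by_cases hx : x ∈ s <;> simp [hx])
  rw [integral_indicator_one hs, integral_indicator_one hs] at this
  exact (measureReal_eq_measureReal_iff).1 this

/-- Geometric drift is inherited by the powers of a kernel. -/
theorem lintegral_pow_le {κ : Kernel ℕ ℕ} [IsMarkovKernel κ] {γ K K' : ℝ≥0} {g : ℕ → ℝ≥0∞}
    (hγ : γ ≤ 1) (hK : γ * K' + K ≤ K') (drift : ∀ x, ∫⁻ y, g y ∂κ x ≤ γ * g x + K) (n : ℕ) (x : ℕ) :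
    ∫⁻ y, g y ∂(κ ^ (n + 1)) x ≤ γ * g x + K' := by
  have hKK : K ≤ K' := le_trans (by simp) hK
  induction n with
  | zero =>
    rw [zero_add, pow_one]
    exact (drift x).trans (by gcongr)
  | succ n ih =>
    have := isMarkovKernel_pow κ (n + 1)
    rw [pow_succ', lintegral_mul]
    calc ∫⁻ y, ∫⁻ z, g z ∂κ y ∂(κ ^ (n + 1)) x
        ≤ ∫⁻ y, (γ * g y + K) ∂(κ ^ (n + 1)) x := lintegral_mono fun y => drift y
      _ = γ * ∫⁻ y, g y ∂(κ ^ (n + 1)) x + K := by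
        rw [lintegral_add_right _ measurable_const, lintegral_const_mul _ (measurable_of_countable g)]
        simp
      _ ≤ γ * (γ * g x + K') + K := by gcongr
      _ = γ * (γ * g x) + ((γ * K' + K : ℝ≥0) : ℝ≥0∞) := by push_cast; ring
      -- The decay `γ ^ (n + 1)` is given up for `γ`; what matters below is that `K'` does not
      -- depend on the number of steps.
      _ ≤ 1 * (γ * g x) + K' := by
        gcongr
        exact_mod_cast hγ
      _ = _ := by rw [one_mul]

/-- The arithmetic of Harris' theorem for the weight `2 + b * s`, with `s = x + y`. For large `s`
the drift alone shrinks the weight. In general a meeting probability `c` gains `2 * c`, and `b = c /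
(2 * K)` is so small that the additive drift term costs only half of this gain. -/
theorem exists_contraction_constants {γ K c : ℝ} (hγ₀ : 0 ≤ γ) (hγ : γ < 1) (hK : 0 < K)
    (hc : 0 < c) : ∃ a b : ℝ, 0 ≤ a ∧ a < 1 ∧ 0 < b ∧ ∀ s : ℝ, 0 ≤ s →
      (4 * K / (1 - γ) ≤ s → 2 + b * (γ * s + 2 * K) ≤ a * (2 + b * s)) ∧
      2 * (1 - c) + b * (γ * s + 2 * K) ≤ a * (2 + b * s) := by
  have h1 : 0 < 1 - γ := by linarith
  set b := c / (2 * K) with hb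
  have hb0 : 0 < b := by positivity
  have hbK : b * (2 * K) = c := by rw [hb]; field_simp
  set R := 4 * K / (1 - γ) with hR
  have hR0 : 0 < R := by positivity
  have hRK : R * (1 - γ) = 4 * K := by rw [hR]; field_simp
  -- Chosen so that `e * (2 + b * s) ≤ (1 - γ) / 2 * (b * s)` is an equality at `s = R`; it persists
  -- for `s ≥ R` since `e ≤ (1 - γ) / 2`.
  set e := (1 - γ) / 2 * (b * R / (2 + b * R)) with he
  have hfrac : b * R / (2 + b * R) < 1 := by rw [div_lt_one (by positivity)]; linarith
  have he0 : 0 < e := by positivity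
  have he1 : e * (2 + b * R) = (1 - γ) / 2 * (b * R) := by rw [he]; field_simp
  have he2 : e ≤ (1 - γ) / 2 := by
    rw [he]; exact mul_le_of_le_one_right (by linarith) hfrac.le
  set a := max (1 - e) (max (1 - c / 2) γ) with ha
  have ha1 : 1 - e ≤ a := le_max_left _ _
  have ha2 : 1 - c / 2 ≤ a := (le_max_left _ _).trans (le_max_right _ _)
  have ha3 : γ ≤ a := (le_max_right _ _).trans (le_max_right _ _)
  refine ⟨a, b, by linarith, max_lt (by linarith) (max_lt (by linarith) hγ), hb0,
    fun s hs => ⟨fun hRs => ?_, ?_⟩⟩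
  · have hbs : 0 ≤ b * s := by positivity
    have k1 : (1 - e) * (2 + b * s) ≤ a * (2 + b * s) := by gcongr
    have k2 : 4 * K ≤ s * (1 - γ) := by rw [← hRK]; gcongr
    have k3 : b * (4 * K) ≤ b * (s * (1 - γ)) := by gcongr
    have k4 : 0 ≤ ((1 - γ) / 2 - e) * (b * (s - R)) := by
      have : 0 ≤ s - R := by linarith
      have : 0 ≤ (1 - γ) / 2 - e := by linarith
      positivity
    nlinarith
  · have k1 : (1 - c / 2) * 2 ≤ a * 2 := by gcongr
    have k2 : γ * (b * s) ≤ a * (b * s) := by gcongr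
    nlinarith

theorem enorm_integral_sub_le {μ ν : Measure ℕ} [IsProbabilityMeasure μ] [IsProbabilityMeasure ν]
    {φ : ℕ → ℝ} (h : ∀ x, |φ x| ≤ 1) :
    ‖∫ x, φ x ∂μ - ∫ y, φ y ∂ν‖ₑ ≤ ∫⁻ z, ‖φ z.1 - φ z.2‖ₑ ∂(μ.prod ν) := by
  have e1 : ∫ x, φ x ∂μ = ∫ z, φ z.1 ∂(μ.prod ν) := by
    rw [integral_fun_fst]; simp
  have e2 : ∫ x, φ x ∂ν = ∫ z, φ z.2 ∂(μ.prod ν) := by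
    rw [integral_fun_snd]; simp
  rw [e1, e2, ← integral_sub]
  · exact enorm_integral_le_lintegral_enorm _
  · exact (integrable_of_abs_le_one h).comp_fst _
  · exact (integrable_of_abs_le_one h).comp_snd _

/-- One step of a coupling argument: if `φ` oscillates at most by `C * (2 + b * x + b * y)`, then
so do its averages, with the constant `2` reduced by the chance of meeting at `1`. -/
theorem enorm_integral_sub_le_of_atom {μ ν : Measure ℕ} [IsProbabilityMeasure μ]
    [IsProbabilityMeasure ν] {φ : ℕ → ℝ} (h : ∀ x, |φ x| ≤ 1) {C b : ℝ≥0∞}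
    (hφ : ∀ x y, ‖φ x - φ y‖ₑ ≤ C * (2 + b * x + b * y)) :
    ‖∫ x, φ x ∂μ - ∫ y, φ y ∂ν‖ₑ ≤
      C * (2 * (1 - μ {1} * ν {1}) + b * ∫⁻ x, (x : ℝ≥0∞) ∂μ + b * ∫⁻ y, (y : ℝ≥0∞) ∂ν) := by
  have hm : MeasurableSet ({((1 : ℕ), (1 : ℕ))}ᶜ : Set (ℕ × ℕ)) := .of_discrete
  refine (enorm_integral_sub_le h).trans ?_
  calc ∫⁻ z, ‖φ z.1 - φ z.2‖ₑ ∂(μ.prod ν)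
      ≤ ∫⁻ z, C * (2 * ({((1 : ℕ), (1 : ℕ))}ᶜ : Set (ℕ × ℕ)).indicator 1 z
          + b * z.1 + b * z.2) ∂(μ.prod ν) := by
        refine lintegral_mono fun z => ?_
        by_cases hz : z = (1, 1)
        · simp [hz]
        · simpa [hz] using hφ z.1 z.2
    _ = _ := by
        rw [lintegral_const_mul _ (measurable_of_countable _),
          lintegral_add_right _ (measurable_of_countable _),
          lintegral_add_right _ (measurable_of_countable _),
          lintegral_const_mul _ (measurable_of_countable _), lintegral_indicator_one hm,
          lintegral_const_mul _ (measurable_of_countable _),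
          lintegral_const_mul _ (measurable_of_countable _),
          prob_compl_eq_one_sub (MeasurableSet.of_discrete)]
        have e1 : ∫⁻ z : ℕ × ℕ, (z.1 : ℝ≥0∞) ∂(μ.prod ν) = ∫⁻ x, (x : ℝ≥0∞) ∂μ := by
          rw [← lintegral_map (f := fun x : ℕ => (x : ℝ≥0∞)) (g := Prod.fst)
            (measurable_of_countable _) measurable_fst]
          simp
        have e2 : ∫⁻ z : ℕ × ℕ, (z.2 : ℝ≥0∞) ∂(μ.prod ν) = ∫⁻ x, (x : ℝ≥0∞) ∂ν := by
          rw [← lintegral_map (f := fun x : ℕ => (x : ℝ≥0∞)) (g := Prod.snd)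
            (measurable_of_countable _) measurable_snd]
          simp
        rw [e1, e2, ← Set.singleton_prod_singleton, Measure.prod_prod]

/-- Harris' theorem in dual form: averaging over one step of two independent copies shrinks the
oscillation weighted by `2 + b * x + b * y`. If both points are at most `N`, the copies meet at `1`
with probability at least `c * c`; otherwise `x + y` is large and the drift suffices. -/
theorem exists_geometric_contraction (T : Kernel ℕ ℕ) [IsMarkovKernel T] {γ K c : ℝ≥0} (hγ : γ < 1)
    (hK : 0 < K) (hc : 0 < c) (drift : ∀ x, ∫⁻ y, (y : ℝ≥0∞) ∂T x ≤ γ * x + K) {N : ℕ}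
    (hN : 4 * (K : ℝ) / (1 - γ) ≤ N) (small : ∀ x ≤ N, (c : ℝ≥0∞) ≤ T x {1}) :
    ∃ a b : ℝ≥0, a < 1 ∧ ∀ φ : ℕ → ℝ, (∀ x, |φ x| ≤ 1) → ∀ (m : ℕ) (x y : ℕ),
      ‖∫ z, φ z ∂(T ^ m) x - ∫ z, φ z ∂(T ^ m) y‖ₑ ≤ (a : ℝ≥0∞) ^ m * (2 + b * x + b * y) := by
  have hc₁ : c ≤ 1 := by
    have := (small 0 (Nat.zero_le _)).trans prob_le_one
    exact_mod_cast this
  obtain ⟨a', b', ha₀, ha, hb, hab⟩ := exists_contraction_constants (γ := γ) (K := K) (c := c * c)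
    γ.2 (by exact_mod_cast hγ) (by exact_mod_cast hK) (by positivity)
  lift a' to ℝ≥0 using ha₀
  lift b' to ℝ≥0 using hb.le
  refine ⟨a', b', by exact_mod_cast ha, fun φ hφ m => ?_⟩
  induction m with
  | zero =>
    intro x y
    calc _ ≤ (2 : ℝ≥0∞) := by
          have := isMarkovKernel_pow T 0
          have h1 := abs_integral_le_one (μ := (T ^ 0 : Kernel ℕ ℕ) x) hφ
          have h2 := abs_integral_le_one (μ := (T ^ 0 : Kernel ℕ ℕ) y) hφ
          rw [← ofReal_norm, Real.norm_eq_abs]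
          refine ENNReal.ofReal_le_of_le_toReal ?_
          rw [ENNReal.toReal_ofNat]
          linarith [abs_sub (∫ z, φ z ∂(T ^ 0) x) (∫ z, φ z ∂(T ^ 0) y)]
      _ ≤ _ := by rw [pow_zero, one_mul, add_assoc]; exact le_self_add
  | succ m ih =>
    intro x y
    have := isMarkovKernel_pow T m
    -- The first step is split off, so that the induction hypothesis bounds the oscillation of the
    -- function averaged over the remaining `m` steps.
    rw [pow_succ, integral_mul _ _ _ hφ, integral_mul _ _ _ hφ]
    refine (enorm_integral_sub_le_of_atom (fun x => abs_integral_le_one hφ) ih).trans ?_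
    rw [pow_succ, mul_assoc]
    gcongr
    have h1 : (2 : ℝ≥0∞) * (1 - T x {1} * T y {1}) + b' * ∫⁻ z, (z : ℝ≥0∞) ∂T x
          + b' * ∫⁻ z, (z : ℝ≥0∞) ∂T y
        ≤ 2 * (1 - T x {1} * T y {1}) + b' * (γ * x + K) + b' * (γ * y + K) := by
      gcongr <;> exact drift _
    refine h1.trans ?_
    obtain ⟨h2, h3⟩ := hab (x + y) (by positivity)
    by_cases hxy : x ≤ N ∧ y ≤ N
    · have h4 : (1 : ℝ≥0∞) - T x {1} * T y {1} ≤ ((1 - c * c : ℝ≥0) : ℝ≥0∞) := by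
        push_cast
        gcongr
        · exact small x hxy.1
        · exact small y hxy.2
      have h5 : 2 * (1 - c * c) + b' * (γ * x + K) + b' * (γ * y + K)
          ≤ a' * (2 + b' * x + b' * y) := by
        rw [← NNReal.coe_le_coe]
        push_cast [NNReal.coe_sub (mul_le_one' hc₁ hc₁)]
        linarith
      calc _ ≤ 2 * ((1 - c * c : ℝ≥0) : ℝ≥0∞) + b' * (γ * x + K) + b' * (γ * y + K) := by gcongr
        _ ≤ _ := by exact_mod_cast h5
    · have h6 : (N : ℝ) ≤ x + y := by
        have : N ≤ x + y := by omega
        exact_mod_cast this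
      have h5 : 2 * 1 + b' * (γ * x + K) + b' * (γ * y + K) ≤ a' * (2 + b' * x + b' * y) := by
        rw [← NNReal.coe_le_coe]
        push_cast
        linarith [h2 (hN.trans h6)]
      calc _ ≤ 2 * (1 : ℝ≥0∞) + b' * (γ * x + K) + b' * (γ * y + K) := by
            gcongr; exact tsub_le_self
        _ ≤ _ := by exact_mod_cast h5

theorem tendsto_integral_pow_sub {T : Kernel ℕ ℕ} [IsMarkovKernel T] {a b : ℝ≥0} (ha : a < 1)
    {φ : ℕ → ℝ} (x y : ℕ) (h : ∀ m : ℕ, ‖∫ z, φ z ∂(T ^ m) x - ∫ z, φ z ∂(T ^ m) y‖ₑ ≤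
      (a : ℝ≥0∞) ^ m * (2 + b * x + b * y)) :
    Tendsto (fun m : ℕ => ∫ z, φ z ∂(T ^ m) x - ∫ z, φ z ∂(T ^ m) y) atTop (𝓝 0) := by
  rw [tendsto_zero_iff_enorm_tendsto_zero]
  refine tendsto_of_tendsto_of_tendsto_of_le_of_le tendsto_const_nhds ?_ (fun _ => zero_le) h
  have h2 : Tendsto (fun m : ℕ => (a : ℝ≥0∞) ^ m * (2 + b * x + b * y)) atTop
      (𝓝 (0 * (2 + b * x + b * y))) :=
    ENNReal.Tendsto.mul_const
      (ENNReal.tendsto_pow_atTop_nhds_zero_of_lt_one (by exact_mod_cast ha))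
      (Or.inr (by exact_mod_cast ENNReal.coe_ne_top (r := 2 + b * x + b * y)))
  simpa using h2

/-- If the averages over the kernel powers forget the starting point, this also holds for two
initial distributions. -/
theorem tendsto_integral_bind_pow_sub {T : Kernel ℕ ℕ} [IsMarkovKernel T] {φ : ℕ → ℝ}
    (hφ : ∀ x, |φ x| ≤ 1) (h : ∀ x y, Tendsto
      (fun m : ℕ => ∫ z, φ z ∂(T ^ m) x - ∫ z, φ z ∂(T ^ m) y) atTop (𝓝 0))
    (μ ν : Measure ℕ) [IsProbabilityMeasure μ] [IsProbabilityMeasure ν] :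
    Tendsto (fun m : ℕ => ∫ z, φ z ∂(μ.bind (T ^ m : Kernel ℕ ℕ))
      - ∫ z, φ z ∂(ν.bind (T ^ m : Kernel ℕ ℕ))) atTop (𝓝 0) := by
  have hT := isMarkovKernel_pow T
  have key : ∀ (μ : Measure ℕ) [IsProbabilityMeasure μ],
      Tendsto (fun m : ℕ => ∫ z, φ z ∂(μ.bind (T ^ m : Kernel ℕ ℕ)) - ∫ z, φ z ∂(T ^ m) 1)
        atTop (𝓝 0) := by
    intro μ _
    have e : ∀ m : ℕ, ∫ z, φ z ∂(μ.bind (T ^ m : Kernel ℕ ℕ)) - ∫ z, φ z ∂(T ^ m) 1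
        = ∫ x, (∫ z, φ z ∂(T ^ m) x - ∫ z, φ z ∂(T ^ m) 1) ∂μ := by
      intro m
      rw [integral_bind _ hφ, integral_sub
        (integrable_of_abs_le_one fun x => abs_integral_le_one hφ) (integrable_const _)]
      simp
    simp_rw [e]
    rw [show (0 : ℝ) = ∫ x, (0 : ℝ) ∂μ by simp]
    refine tendsto_integral_of_dominated_convergence (fun _ => 2)
      (fun m => (measurable_of_countable _).aestronglyMeasurable) (integrable_const _)
      (fun m => ae_of_all _ fun x => ?_) (ae_of_all _ fun x => h x 1)
    rw [Real.norm_eq_abs]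
    have h1 := abs_integral_le_one (μ := (T ^ m : Kernel ℕ ℕ) x) hφ
    have h2 := abs_integral_le_one (μ := (T ^ m : Kernel ℕ ℕ) 1) hφ
    linarith [abs_sub (∫ z, φ z ∂(T ^ m) x) (∫ z, φ z ∂(T ^ m) 1)]
  simpa using (key μ).sub (key ν)

/-- Bounded means give uniform tails by Markov's inequality, and the measures with such tails form a
compact set. A limit along an ultrafilter spares the choice of subsequences. -/
theorem exists_tendsto_of_tight {m : ℕ → Measure ℕ} [∀ n, IsProbabilityMeasure (m n)] {C : ℝ≥0}
    (h : ∀ n, ∫⁻ y, (y : ℝ≥0∞) ∂m n ≤ C) :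
    ∃ π : Measure ℕ, IsProbabilityMeasure π ∧ ∀ φ : ℕ → ℝ, (∀ x, |φ x| ≤ 1) →
      Tendsto (fun n => ∫ x, φ x ∂m n) (hyperfilter ℕ) (𝓝 (∫ x, φ x ∂π)) := by
  have hu : Tendsto (fun n : ℕ => C / ((n : ℝ≥0) + 1)) atTop (𝓝 0) := by
    rw [← NNReal.tendsto_coe]
    have := (tendsto_const_div_atTop_nhds_zero_nat (C : ℝ)).comp (tendsto_add_atTop_nat 1)
    simpa [Function.comp_def] using this
  have hc := isCompact_setOfPred_probabilityMeasure_mass_eq_compl_isCompact_le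
    (E := ℕ) hu (K := fun n => Set.Iic n) (fun n => (Set.finite_Iic n).isCompact)
    (Or.inl inferInstance)
  rw [isCompact_iff_ultrafilter_le_nhds] at hc
  let M : ℕ → ProbabilityMeasure ℕ := fun n => ⟨m n, inferInstance⟩
  have hM : ∀ n k : ℕ, M n (Set.Iic k)ᶜ ≤ C / ((k : ℝ≥0) + 1) := by
    intro n k
    rw [← ENNReal.coe_le_coe, ProbabilityMeasure.ennreal_coeFn_eq_coeFn_toMeasure]
    change m n (Set.Iic k)ᶜ ≤ _
    rw [ENNReal.coe_div (by positivity)]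
    calc m n (Set.Iic k)ᶜ ≤ m n {y | (k + 1 : ℝ≥0∞) ≤ (y : ℝ≥0∞)} := by
          refine measure_mono fun y hy => ?_
          have : k + 1 ≤ y := by simpa using hy
          change (k + 1 : ℝ≥0∞) ≤ (y : ℝ≥0∞)
          exact_mod_cast this
      _ ≤ (∫⁻ y, (y : ℝ≥0∞) ∂m n) / (k + 1) :=
          meas_ge_le_lintegral_div (measurable_of_countable _).aemeasurable (by simp) (by simp)
      _ ≤ _ := by push_cast; gcongr; exact h n
  obtain ⟨π, -, hπ⟩ := hc ((hyperfilter ℕ).map M) (tendsto_principal.2 (Eventually.of_forall hM))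
  refine ⟨π, inferInstance, fun φ hφ => ?_⟩
  have := ProbabilityMeasure.tendsto_iff_forall_integral_tendsto.1
    (show Tendsto M (hyperfilter ℕ) (𝓝 π) from hπ)
    (BoundedContinuousFunction.ofNormedAddCommGroup φ continuous_of_discreteTopology 1 hφ)
  exact this

/-- A Markov chain on `ℕ` with geometric drift towards `0`, which reaches `1` from every state,
has an invariant distribution, to which it converges (along multiples of some time lag). -/
theorem exists_invariant_and_tendsto (κ : Kernel ℕ ℕ) [IsMarkovKernel κ] {γ K c : ℝ≥0}
    (hγ : γ < 1) (drift : ∀ x, ∫⁻ y, (y : ℝ≥0∞) ∂κ x ≤ γ * x + K) (hc : 0 < c)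
    (reach : ∀ n x : ℕ, 1 ≤ n → x ≤ n → (c : ℝ≥0∞) ^ n ≤ (κ ^ n) x {1}) :
    ∃ (N : ℕ) (π : Measure ℕ), IsProbabilityMeasure π ∧ π.bind κ = π ∧
      ∀ (μ : Measure ℕ) [IsProbabilityMeasure μ] (φ : ℕ → ℝ), (∀ x, |φ x| ≤ 1) →
        Tendsto (fun m : ℕ => ∫ x, φ x ∂(μ.bind (κ ^ (N * m) : Kernel ℕ ℕ))) atTop
          (𝓝 (∫ x, φ x ∂π)) := by
  have h1γ : (0 : ℝ) < 1 - γ := by rw [sub_pos]; exact_mod_cast hγ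
  -- One drift constant for all powers of `κ`; the `+ 1` keeps it positive. As it does not depend on
  -- the power, the threshold `4 * K' / (1 - γ)` can be fixed first, and then `N` serves both as
  -- number of steps and as radius of the small set.
  set K' : ℝ≥0 := (K + 1) / (1 - γ) with hK'
  have h1γ' : (1 - γ : ℝ≥0) ≠ 0 := (tsub_pos_of_lt hγ).ne'
  have hK'0 : 0 < K' := by have := tsub_pos_of_lt hγ; positivity
  have hKK : γ * K' + K ≤ K' := by
    have : K' * (1 - γ) = K + 1 := by rw [hK']; field_simp
    rw [← NNReal.coe_inj] at this
    rw [← NNReal.coe_le_coe]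
    push_cast [NNReal.coe_sub hγ.le] at this ⊢
    linarith
  obtain ⟨N₀, hN₀⟩ := exists_nat_ge (4 * (K' : ℝ) / (1 - γ))
  set N := N₀ + 1 with hN
  have hκ := isMarkovKernel_pow κ
  have driftN := lintegral_pow_le hγ.le hKK drift
  obtain ⟨a, b, ha, hab⟩ := exists_geometric_contraction (κ ^ N) hγ hK'0 (pow_pos hc N)
    (driftN N₀) (N := N) (hN₀.trans (by simp [hN]))
    (fun x hx => by rw [ENNReal.coe_pow]; exact reach N x (by omega) hx)
  have hdiff : ∀ (μ ν : Measure ℕ) [IsProbabilityMeasure μ] [IsProbabilityMeasure ν] (φ : ℕ → ℝ),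
      (∀ x, |φ x| ≤ 1) → Tendsto (fun m : ℕ => ∫ z, φ z ∂(μ.bind (κ ^ (N * m) : Kernel ℕ ℕ))
        - ∫ z, φ z ∂(ν.bind (κ ^ (N * m) : Kernel ℕ ℕ))) atTop (𝓝 0) := by
    intro μ ν _ _ φ hφ
    simp_rw [pow_mul]
    exact tendsto_integral_bind_pow_sub hφ
      (fun x y => tendsto_integral_pow_sub ha x y fun m => hab φ hφ m x y) μ ν
  have hbind : ∀ (μ : Measure ℕ) [IsProbabilityMeasure μ] (n : ℕ),
      IsProbabilityMeasure (μ.bind (κ ^ n : Kernel ℕ ℕ)) := by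
    intro μ _ n
    infer_instance
  obtain ⟨π, hπ, hlim⟩ := exists_tendsto_of_tight
    (m := fun m => (Measure.dirac 1).bind (κ ^ (N * m) : Kernel ℕ ℕ)) (C := 1 + K') (fun m => by
      rw [Measure.dirac_bind (Kernel.measurable _)]
      rcases Nat.eq_zero_or_pos (N * m) with h0 | h0
      · rw [h0, pow_zero, lintegral_one]
        simp
      · obtain ⟨j, hj⟩ := Nat.exists_eq_succ_of_ne_zero h0.ne'
        rw [hj]
        refine (driftN j 1).trans ?_
        push_cast
        gcongr
        simpa using hγ.le)
  have hconv : ∀ (μ : Measure ℕ) [IsProbabilityMeasure μ] (φ : ℕ → ℝ), (∀ x, |φ x| ≤ 1) →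
      Tendsto (fun m : ℕ => ∫ x, φ x ∂(μ.bind (κ ^ (N * m) : Kernel ℕ ℕ))) (hyperfilter ℕ)
        (𝓝 (∫ x, φ x ∂π)) := by
    intro μ _ φ hφ
    simpa using ((hdiff μ (Measure.dirac 1) φ hφ).mono_left Nat.hyperfilter_le_atTop).add
      (hlim φ hφ)
  have hinv : ∀ ρ : Measure ℕ, IsProbabilityMeasure ρ → ρ.bind (κ ^ N : Kernel ℕ ℕ) = ρ →
      ρ = π := by
    intro ρ _ hρ
    have hρm : ∀ m : ℕ, ρ.bind (κ ^ (N * m) : Kernel ℕ ℕ) = ρ := by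
      intro m
      induction m with
      | zero => rw [Nat.mul_zero, pow_zero, bind_one]
      | succ m ih => rw [Nat.mul_succ, pow_add, bind_mul, hρ, ih]
    refine measure_eq_of_integral_eq fun φ hφ => ?_
    have := hconv ρ φ hφ
    simp_rw [hρm] at this
    exact tendsto_nhds_unique tendsto_const_nhds this
  -- Running the chain `N` steps longer does not change the limit, because the limit is the same
  -- from every initial law.
  have hπN : π.bind (κ ^ N : Kernel ℕ ℕ) = π := by
    refine measure_eq_of_integral_eq fun φ hφ => ?_
    have h1 := hlim (fun x => ∫ z, φ z ∂(κ ^ N) x) (fun x => abs_integral_le_one hφ)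
    rw [integral_bind _ hφ]
    refine tendsto_nhds_unique h1 ?_
    have h2 := hconv ((Measure.dirac 1).bind (κ ^ N : Kernel ℕ ℕ)) φ hφ
    refine h2.congr fun m => ?_
    rw [← bind_mul, ← pow_add, add_comm, pow_add, bind_mul, integral_bind _ hφ]
  -- `κ` commutes with `κ ^ N`, so `π.bind κ` is invariant under `κ ^ N` too, and uniqueness
  -- applies.
  have hπκ : π.bind κ = π := by
    refine hinv _ inferInstance ?_
    rw [← bind_mul, ← pow_succ, pow_succ', bind_mul, hπN]
  refine ⟨N, π, hπ, hπκ, fun μ _ φ hφ => ?_⟩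
  have hπm : ∀ m : ℕ, π.bind (κ ^ m : Kernel ℕ ℕ) = π := by
    intro m
    induction m with
    | zero => rw [pow_zero, bind_one]
    | succ m ih => rw [pow_succ, bind_mul, hπκ, ih]
  have := hdiff μ π φ hφ
  simp_rw [hπm] at this
  simpa using this.add_const (∫ x, φ x ∂π)

end MarkovChain

/-! ### Measurability of windows and loss epochs -/

namespace TCPCompound

open Filter Topology
open scoped ENNReal NNReal

theorem measurable_sInf_of_measurableSet {Ω : Type*} [MeasurableSpace Ω] {A : ℕ → Set Ω}
    (hA : ∀ n, MeasurableSet (A n)) : Measurable fun ω => sInf {n | ω ∈ A n} := by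
  refine measurable_of_Iic fun m => ?_
  -- The intersection accounts for `sInf ∅ = 0`.
  have : (fun ω => sInf {n | ω ∈ A n}) ⁻¹' Set.Iic m
      = (⋃ i ∈ Set.Iic m, A i) ∪ ⋂ i, (A i)ᶜ := by
    ext ω
    simp only [Set.mem_preimage, Set.mem_Iic, Set.mem_union, Set.mem_iUnion, Set.mem_iInter,
      Set.mem_compl_iff, exists_prop]
    constructor
    · intro h
      by_cases hne : {n | ω ∈ A n}.Nonempty
      · exact Or.inl ⟨_, h, Nat.sInf_mem hne⟩
      · exact Or.inr fun i hi => hne ⟨i, hi⟩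
    · rintro (⟨i, him, hi⟩ | h)
      · exact (Nat.sInf_le hi).trans him
      · have : {n | ω ∈ A n} = ∅ := Set.eq_empty_of_forall_notMem h
        rw [this, Nat.sInf_empty]
        exact Nat.zero_le m
  rw [this]
  exact (MeasurableSet.biUnion (Set.to_countable _) fun i _ => hA i).union
    (MeasurableSet.iInter fun i => (hA i).compl)

section Measurability

variable (α β k : ℝ)

theorem measurableSet_exists_lost {f : Scenario → ℕ} (hf : Measurable f) (n : ℕ) :
    MeasurableSet {ω : Scenario | ∃ i < f ω, ω.2 (n, i) = true} := by
  have : {ω : Scenario | ∃ i < f ω, ω.2 (n, i) = true}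
      = ⋃ i : ℕ, (f ⁻¹' Set.Ioi i) ∩ {ω | ω.2 (n, i) = true} := by
    ext ω; simp
  rw [this]
  refine MeasurableSet.iUnion fun i => (hf measurableSet_Ioi).inter ?_
  have h : Measurable fun ω : Scenario => ω.2 (n, i) := (measurable_pi_apply _).comp measurable_snd
  exact h (measurableSet_singleton true)

theorem measurable_window (n : ℕ) : Measurable fun ω => window α β k ω n := by
  induction n with
  | zero => exact measurable_fst
  | succ n ih =>
    simp only [window]
    exact Measurable.ite (measurableSet_exists_lost ih n)
      ((measurable_of_countable (decrease β)).comp ih)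
      ((measurable_of_countable (increase α k)).comp ih)

theorem measurableSet_hasLoss (n : ℕ) : MeasurableSet {ω | HasLoss α β k ω n} :=
  measurableSet_exists_lost (measurable_window α β k n) n

theorem measurable_lossEpoch (j : ℕ) : Measurable fun ω => lossEpoch α β k ω j := by
  induction j with
  | zero => exact measurable_const
  | succ j ih =>
    simp only [lossEpoch]
    refine Measurable.add_const (measurable_sInf_of_measurableSet
      (A := fun n => {ω | lossEpoch α β k ω j ≤ n ∧ HasLoss α β k ω n}) fun n => ?_) 1
    exact (ih measurableSet_Iic).inter (measurableSet_hasLoss α β k n)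

theorem measurable_lossWindow (j : ℕ) : Measurable (lossWindow α β k j) := by
  have h : Measurable fun x : ℕ × Scenario => window α β k x.2 x.1 :=
    measurable_from_prod_countable_right fun n => measurable_window α β k n
  exact h.comp ((measurable_lossEpoch α β k j).prodMk measurable_id)

theorem measurable_interLossTime (j : ℕ) : Measurable (interLossTime α β k j) :=
  (measurable_lossEpoch α β k (j + 1)).sub (measurable_lossEpoch α β k j)

/-- The scenario seen from time `t` on. -/
noncomputable def shift (t : ℕ) (ω : Scenario) : Scenario :=
  (window α β k ω t, fun x => ω.2 (x.1 + t, x.2))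

theorem measurable_shift (t : ℕ) : Measurable (shift α β k t) := by
  refine (measurable_window α β k t).prodMk (measurable_pi_lambda _ fun x => ?_)
  exact (measurable_pi_apply _).comp measurable_snd

/-- The scenario seen from the first loss epoch on. -/
noncomputable def lossShift (ω : Scenario) : Scenario := shift α β k (lossEpoch α β k ω 1) ω

theorem measurable_lossShift : Measurable (lossShift α β k) := by
  have h : Measurable fun x : ℕ × Scenario => shift α β k x.1 x.2 :=
    measurable_from_prod_countable_right fun n => measurable_shift α β k n
  exact h.comp ((measurable_lossEpoch α β k 1).prodMk measurable_id)

end Measurability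

/-! ### Pathwise shift identities and the first loss -/

section Paths

variable {α β k : ℝ}

theorem window_shift (t n : ℕ) (ω : Scenario) :
    window α β k (shift α β k t ω) n = window α β k ω (n + t) := by
  induction n with
  | zero => simp [window, shift]
  | succ n ih =>
    rw [Nat.succ_add, window, window, ih]
    rfl

theorem hasLoss_shift (t n : ℕ) (ω : Scenario) :
    HasLoss α β k (shift α β k t ω) n ↔ HasLoss α β k ω (n + t) := by
  rw [HasLoss, HasLoss, window_shift]
  rfl

theorem lossEpoch_one (ω : Scenario) :
    lossEpoch α β k ω 1 = sInf {n | HasLoss α β k ω n} + 1 := by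
  simp [lossEpoch]

/-- Infinitely many losses are required, since after a last loss the junk value `sInf ∅ = 0` would
spoil the translation. -/
theorem lossEpoch_succ_eq {ω : Scenario} (hω : ∀ n, ∃ m, n ≤ m ∧ HasLoss α β k ω m) (j : ℕ) :
    lossEpoch α β k ω (j + 1)
      = lossEpoch α β k (lossShift α β k ω) j + lossEpoch α β k ω 1 := by
  induction j with
  | zero => simp [lossEpoch]
  | succ j ih =>
    have h := fun n => hasLoss_shift (α := α) (β := β) (k := k) (lossEpoch α β k ω 1) n ω
    set T := lossEpoch α β k ω 1
    set S := lossEpoch α β k (lossShift α β k ω) j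
    have key : sInf {n | S + T ≤ n ∧ HasLoss α β k ω n}
        = sInf {n | S ≤ n ∧ HasLoss α β k (lossShift α β k ω) n} + T := by
      obtain ⟨m, hm, hm'⟩ := hω (S + T)
      have h1 := Nat.sInf_mem (s := {n | S + T ≤ n ∧ HasLoss α β k ω n}) ⟨m, hm, hm'⟩
      have h2 := Nat.sInf_mem (s := {n | S ≤ n ∧ HasLoss α β k (lossShift α β k ω) n})
        ⟨m - T, by omega, by
          rw [lossShift, h, Nat.sub_add_cancel (by omega)]; exact hm'⟩
      set a := sInf {n | S + T ≤ n ∧ HasLoss α β k ω n}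
      set b := sInf {n | S ≤ n ∧ HasLoss α β k (lossShift α β k ω) n}
      refine le_antisymm (Nat.sInf_le ⟨by have := h2.1; omega, (h b).1 h2.2⟩) ?_
      have : b ≤ a - T := Nat.sInf_le ⟨by have := h1.1; omega, by
        rw [lossShift, h, Nat.sub_add_cancel (by have := h1.1; omega)]; exact h1.2⟩
      have := h1.1
      omega
    calc lossEpoch α β k ω (j + 2)
        = sInf {n | lossEpoch α β k ω (j + 1) ≤ n ∧ HasLoss α β k ω n} + 1 := rfl
      _ = sInf {n | S ≤ n ∧ HasLoss α β k (lossShift α β k ω) n} + T + 1 := by rw [ih, key]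
      _ = _ := by rw [add_right_comm]; rfl

theorem lossWindow_succ {ω : Scenario} (hω : ∀ n, ∃ m, n ≤ m ∧ HasLoss α β k ω m) (j : ℕ) :
    lossWindow α β k (j + 1) ω = lossWindow α β k j (lossShift α β k ω) := by
  rw [lossWindow, lossEpoch_succ_eq hω, lossWindow, ← window_shift]
  rfl

theorem interLossTime_succ {ω : Scenario} (hω : ∀ n, ∃ m, n ≤ m ∧ HasLoss α β k ω m) (j : ℕ) :
    interLossTime α β k (j + 1) ω = interLossTime α β k j (lossShift α β k ω) := by
  rw [interLossTime, lossEpoch_succ_eq hω (j + 1), lossEpoch_succ_eq hω j, interLossTime]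
  omega

/-- The first loss happens in the RTT from `t` to `t + 1`. -/
def firstLoss (α β k : ℝ) (t : ℕ) : Set Scenario :=
  {ω | (∀ i < t, ¬ HasLoss α β k ω i) ∧ HasLoss α β k ω t}

theorem measurableSet_noLoss (t : ℕ) : MeasurableSet {ω | ∀ i < t, ¬ HasLoss α β k ω i} := by
  have : {ω | ∀ i < t, ¬ HasLoss α β k ω i} = ⋂ i ∈ Set.Iio t, {ω | HasLoss α β k ω i}ᶜ := by
    ext ω; simp
  rw [this]
  exact MeasurableSet.biInter (Set.to_countable _) fun i _ =>
    (measurableSet_hasLoss α β k i).compl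

theorem measurableSet_firstLoss (t : ℕ) : MeasurableSet (firstLoss α β k t) :=
  (measurableSet_noLoss t).inter (measurableSet_hasLoss α β k t)

theorem lossEpoch_one_of_mem_firstLoss {t : ℕ} {ω : Scenario} (h : ω ∈ firstLoss α β k t) :
    lossEpoch α β k ω 1 = t + 1 := by
  rw [lossEpoch_one]
  congr 1
  refine le_antisymm (Nat.sInf_le h.2) ?_
  by_contra! hlt
  exact h.1 _ hlt (Nat.sInf_mem (s := {n | HasLoss α β k ω n}) ⟨t, h.2⟩)

theorem pairwise_disjoint_firstLoss :
    Pairwise (Function.onFun Disjoint (firstLoss α β k)) := by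
  intro s t hst
  rw [Function.onFun, Set.disjoint_left]
  intro ω h1 h2
  have := lossEpoch_one_of_mem_firstLoss h1
  have := lossEpoch_one_of_mem_firstLoss h2
  omega

theorem exists_mem_firstLoss {ω : Scenario} (h : ∃ n, HasLoss α β k ω n) :
    ∃ t, ω ∈ firstLoss α β k t := by
  classical
  exact ⟨Nat.find h, fun i hi => Nat.find_min h hi, Nat.find_spec h⟩

theorem mem_firstLoss_zero {ω : Scenario} : ω ∈ firstLoss α β k 0 ↔ HasLoss α β k ω 0 := by
  simp [firstLoss]

theorem forall_noLoss_succ {t : ℕ} {ω : Scenario} : (∀ i < t + 1, ¬ HasLoss α β k ω i) ↔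
    ¬ HasLoss α β k ω 0 ∧ ∀ i < t, ¬ HasLoss α β k (shift α β k 1 ω) i := by
  simp_rw [hasLoss_shift]
  rw [Nat.forall_lt_succ_left']

theorem mem_firstLoss_succ {t : ℕ} {ω : Scenario} : ω ∈ firstLoss α β k (t + 1) ↔
    ¬ HasLoss α β k ω 0 ∧ shift α β k 1 ω ∈ firstLoss α β k t := by
  change ((∀ i < t + 1, ¬ HasLoss α β k ω i) ∧ HasLoss α β k ω (t + 1)) ↔
    ¬ HasLoss α β k ω 0 ∧ (∀ i < t, ¬ HasLoss α β k (shift α β k 1 ω) i) ∧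
      HasLoss α β k (shift α β k 1 ω) t
  rw [forall_noLoss_succ, hasLoss_shift, and_assoc]

theorem shift_succ (t : ℕ) (ω : Scenario) :
    shift α β k (t + 1) ω = shift α β k t (shift α β k 1 ω) := by
  refine Prod.ext ?_ ?_
  · exact (window_shift 1 t ω).symm
  · funext x
    simp only [shift]
    rw [add_assoc]

end Paths

/-! ### Independence of the first RTT from the later ones -/

section Field

/-- The law of the losses of all packets. -/
noncomputable abbrev lossLaw (p : unitInterval) : Measure (ℕ × ℕ → Bool) :=
  Measure.infinitePi fun _ : ℕ × ℕ => bernoulliMeasure true false p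

/-- The probability that a packet is not lost. -/
noncomputable def keep (p : unitInterval) : ℝ≥0∞ := bernoulliMeasure true false p {false}

theorem keep_le_one (p : unitInterval) : keep p ≤ 1 := prob_le_one

theorem keep_toReal (p : unitInterval) : (keep p).toReal = 1 - p := by
  have := bernoulliMeasure_real_apply_of_notMem_of_mem (x := true) (y := false) p
    (s := {false}) (by measurability) (by simp) (by simp)
  exact this

theorem keep_lt_one {p : unitInterval} (hp : 0 < p) : keep p < 1 := by
  rw [← ENNReal.toReal_lt_toReal ((keep_le_one p).trans_lt ENNReal.one_lt_top).ne ENNReal.one_ne_top,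
    keep_toReal, ENNReal.toReal_one]
  have : (0 : ℝ) < p := hp
  linarith

theorem keep_ne_zero {p : unitInterval} (hp : p < 1) : keep p ≠ 0 := by
  intro h
  have h1 := keep_toReal p
  rw [h, ENNReal.toReal_zero] at h1
  have : (p : ℝ) < 1 := hp
  linarith

theorem keep_ne_top (p : unitInterval) : keep p ≠ ∞ :=
  ((keep_le_one p).trans_lt ENNReal.one_lt_top).ne

/-- The losses from time `1` on. -/
def fieldShift (η : ℕ × ℕ → Bool) : ℕ × ℕ → Bool := fun x => η (x.1 + 1, x.2)

theorem measurable_fieldShift : Measurable fieldShift :=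
  measurable_pi_lambda _ fun x => measurable_pi_apply (x.1 + 1, x.2)

theorem measurableSet_keepFirst (w : ℕ) :
    MeasurableSet {η : ℕ × ℕ → Bool | ∀ i < w, η (0, i) = false} := by
  have : {η : ℕ × ℕ → Bool | ∀ i < w, η (0, i) = false}
      = ⋂ i ∈ Set.Iio w, (fun η : ℕ × ℕ → Bool => η (0, i)) ⁻¹' {false} := by
    ext; simp
  rw [this]
  exact MeasurableSet.biInter (Set.to_countable _) fun i _ =>
    (measurable_pi_apply _) (measurableSet_singleton _)

/-- Conditioned on no loss among the first `w` packets of RTT `0`, the shifted field has the right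
probabilities on cylinders, hence is again the product measure. Dividing by `keep p ^ w` needs `p <
1`. -/
theorem lossLaw_keepFirst_inter {p : unitInterval} (hp : p < 1) (w : ℕ)
    {C : Set (ℕ × ℕ → Bool)} (hC : MeasurableSet C) :
    lossLaw p ({η | ∀ i < w, η (0, i) = false} ∩ fieldShift ⁻¹' C)
      = keep p ^ w * lossLaw p C := by
  have h0 : keep p ^ w ≠ 0 := pow_ne_zero _ (keep_ne_zero hp)
  have htop : keep p ^ w ≠ ∞ := ENNReal.pow_ne_top (keep_ne_top p)
  have key : (keep p ^ w)⁻¹ •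
      ((lossLaw p).restrict {η | ∀ i < w, η (0, i) = false}).map fieldShift = lossLaw p := by
    refine Measure.eq_infinitePi _ fun s t ht => ?_
    have hm : MeasurableSet ((s : Set (ℕ × ℕ)).pi t) :=
      MeasurableSet.pi s.countable_toSet fun i _ => ht i
    rw [Measure.smul_apply, Measure.map_apply measurable_fieldShift hm,
      Measure.restrict_apply (measurable_fieldShift hm), smul_eq_mul]
    let e₁ : ℕ ↪ ℕ × ℕ := ⟨fun i => (0, i), fun i j h => by simpa using h⟩
    let e₂ : ℕ × ℕ ↪ ℕ × ℕ := ⟨fun x => (x.1 + 1, x.2), fun x y h => by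
      simpa [Prod.ext_iff] using h⟩
    let t' : ℕ × ℕ → Set Bool := fun x => if x.1 = 0 then {false} else t (x.1 - 1, x.2)
    have he₁ : ∀ i, e₁ i = (0, i) := fun _ => rfl
    have he₂ : ∀ x, e₂ x = (x.1 + 1, x.2) := fun _ => rfl
    have ht₁ : ∀ i, t' (0, i) = {false} := fun _ => rfl
    have ht₂ : ∀ x : ℕ × ℕ, t' (x.1 + 1, x.2) = t x := fun _ => rfl
    have hd : Disjoint ((Finset.range w).map e₁) (s.map e₂) := by
      rw [Finset.disjoint_left]
      intro x hx hx'
      simp only [Finset.mem_map] at hx hx'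
      obtain ⟨i, -, rfl⟩ := hx
      obtain ⟨y, -, hy⟩ := hx'
      have := congrArg Prod.fst hy
      simp [he₁, he₂] at this
    have hset : fieldShift ⁻¹' (s : Set (ℕ × ℕ)).pi t ∩ {η | ∀ i < w, η (0, i) = false}
        = Set.pi (((Finset.range w).map e₁).disjUnion (s.map e₂) hd : Finset (ℕ × ℕ)) t' := by
      ext η
      simp only [Set.mem_inter_iff, Set.mem_preimage, Set.mem_pi, Finset.mem_coe,
        Set.mem_ofPred_eq, Finset.mem_disjUnion, Finset.mem_map, Finset.mem_range]
      constructor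
      · rintro ⟨h1, h2⟩ x (⟨i, hi, rfl⟩ | ⟨y, hy, rfl⟩)
        · rw [he₁, ht₁]
          exact h2 i hi
        · rw [he₂, ht₂]
          exact h1 y hy
      · intro h
        refine ⟨fun y hy => ?_, fun i hi => ?_⟩
        · have := h (e₂ y) (Or.inr ⟨y, hy, rfl⟩)
          rwa [he₂, ht₂] at this
        · have := h (e₁ i) (Or.inl ⟨i, hi, rfl⟩)
          rwa [he₁, ht₁] at this
    rw [hset, Measure.infinitePi_pi _ (fun i _ => by measurability), Finset.prod_disjUnion,
      Finset.prod_map, Finset.prod_map]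
    simp only [he₁, he₂, ht₁, ht₂, Finset.prod_const, Finset.card_range]
    change (keep p ^ w)⁻¹ * (keep p ^ w * _) = _
    rw [← mul_assoc, ENNReal.inv_mul_cancel h0 htop, one_mul]
  conv_rhs => rw [← key]
  rw [Measure.smul_apply, Measure.map_apply measurable_fieldShift hC,
    Measure.restrict_apply (measurable_fieldShift hC), smul_eq_mul, ← mul_assoc,
    ENNReal.mul_inv_cancel h0 htop, one_mul, Set.inter_comm]

theorem lossLaw_compl_keepFirst_inter {p : unitInterval} (hp : p < 1) (w : ℕ)
    {C : Set (ℕ × ℕ → Bool)} (hC : MeasurableSet C) :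
    lossLaw p ({η | ∀ i < w, η (0, i) = false}ᶜ ∩ fieldShift ⁻¹' C)
      = (1 - keep p ^ w) * lossLaw p C := by
  -- With no packet constrained, this says that `fieldShift` preserves `lossLaw p`.
  have h0 := lossLaw_keepFirst_inter hp 0 hC
  have h1 := lossLaw_keepFirst_inter hp w hC
  simp only [not_lt_zero, IsEmpty.forall_iff, implies_true, Set.ofPred_true, Set.univ_inter,
    pow_zero, one_mul] at h0
  rw [ENNReal.sub_mul (fun _ _ => measure_ne_top _ _), one_mul, ← h1, ← h0,
    ← measure_inter_add_sdiff (fieldShift ⁻¹' C) (measurableSet_keepFirst w),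
    Set.inter_comm (fieldShift ⁻¹' C), ENNReal.add_sub_cancel_left (measure_ne_top _ _),
    Set.inter_comm, ← Set.sdiff_eq]

end Field

/-! ### Markov property for a fixed initial window -/

section Start

variable {α β k : ℝ} {p : unitInterval}

/-- The law of the scenario with initial window `v`. -/
noncomputable abbrev startLaw (p : unitInterval) (v : ℕ) : Measure Scenario :=
  scenarioLaw p (Measure.dirac v)

theorem startLaw_apply (v : ℕ) {B : Set Scenario} (hB : MeasurableSet B) :
    startLaw p v B = lossLaw p {η | (v, η) ∈ B} := by
  rw [startLaw, scenarioLaw, Measure.prod_apply hB, lintegral_dirac]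
  rfl

theorem scenarioLaw_apply (μ : Measure ℕ) {B : Set Scenario} (hB : MeasurableSet B) :
    scenarioLaw p μ B = ∫⁻ v, startLaw p v B ∂μ := by
  simp_rw [startLaw_apply _ hB]
  rw [scenarioLaw, Measure.prod_apply hB]
  rfl

instance isProbabilityMeasure_scenarioLaw (μ : Measure ℕ) [IsProbabilityMeasure μ] :
    IsProbabilityMeasure (scenarioLaw p μ) := by
  rw [scenarioLaw]; infer_instance

theorem hasLoss_zero_iff (v : ℕ) (η : ℕ × ℕ → Bool) :
    HasLoss α β k (v, η) 0 ↔ ¬ ∀ i < v, η (0, i) = false := by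
  simp [HasLoss, window]

theorem startLaw_noLoss_inter (hp : p < 1) (v : ℕ) {B : Set Scenario} (hB : MeasurableSet B) :
    startLaw p v ({ω | ¬ HasLoss α β k ω 0} ∩ shift α β k 1 ⁻¹' B)
      = keep p ^ v * startLaw p (increase α k v) B := by
  have hm : MeasurableSet ({ω | ¬ HasLoss α β k ω 0} ∩ shift α β k 1 ⁻¹' B) :=
    (measurableSet_hasLoss α β k 0).compl.inter (measurable_shift α β k 1 hB)
  have hB' : MeasurableSet {η | (increase α k v, η) ∈ B} := measurable_prodMk_left hB
  rw [startLaw_apply _ hm, startLaw_apply _ hB, ← lossLaw_keepFirst_inter hp v hB']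
  congr 1
  ext η
  simp only [Set.mem_ofPred_eq, Set.mem_inter_iff, Set.mem_preimage, hasLoss_zero_iff, not_not]
  refine and_congr_right fun h => ?_
  have : shift α β k 1 (v, η) = (increase α k v, fieldShift η) := by
    refine Prod.ext ?_ rfl
    have h' := (hasLoss_zero_iff (α := α) (β := β) (k := k) v η).not.2 (not_not.2 h)
    exact if_neg h'
  rw [this]

theorem startLaw_loss_inter (hp : p < 1) (v : ℕ) {B : Set Scenario} (hB : MeasurableSet B) :
    startLaw p v ({ω | HasLoss α β k ω 0} ∩ shift α β k 1 ⁻¹' B)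
      = (1 - keep p ^ v) * startLaw p (decrease β v) B := by
  have hB' : MeasurableSet {η | (decrease β v, η) ∈ B} := measurable_prodMk_left hB
  rw [startLaw_apply _ ((measurableSet_hasLoss α β k 0).inter (measurable_shift α β k 1 hB)),
    startLaw_apply _ hB, ← lossLaw_compl_keepFirst_inter hp v hB']
  congr 1
  ext η
  simp only [Set.mem_ofPred_eq, Set.mem_inter_iff, Set.mem_preimage, hasLoss_zero_iff,
    Set.mem_compl_iff]
  refine and_congr_right fun h => ?_
  have : shift α β k 1 (v, η) = (decrease β v, fieldShift η) := by
    refine Prod.ext ?_ rfl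
    exact if_pos ((hasLoss_zero_iff (α := α) (β := β) (k := k) v η).2 h)
  rw [this]

theorem lt_increase (v : ℕ) : v + 1 ≤ increase α k v := by
  refine Nat.le_floor ?_
  push_cast
  linarith [le_max_right (α * (v : ℝ) ^ k - 1) 0]

theorem one_le_decrease (v : ℕ) : 1 ≤ decrease β v := le_max_left _ _

/-- The probability that from window `v` on there is no loss for `t` RTTs. -/
noncomputable def survival (α k : ℝ) (p : unitInterval) (v : ℕ) : ℕ → ℝ≥0∞
  | 0 => 1
  | t + 1 => keep p ^ v * survival α k p (increase α k v) t

theorem startLaw_forall_noLoss (hp : p < 1) (t v : ℕ) :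
    startLaw p v {ω | ∀ i < t, ¬ HasLoss α β k ω i} = survival α k p v t := by
  induction t generalizing v with
  | zero => simp [survival]
  | succ t ih =>
    rw [survival, ← ih, ← startLaw_noLoss_inter (β := β) hp v (measurableSet_noLoss t)]
    congr 1
    ext ω
    exact forall_noLoss_succ

/-- Until the first loss the window is deterministic, an iterate of `increase`; so the Markov
property at time `1`, used once per RTT, gives the Markov property at the first loss epoch. -/
theorem startLaw_firstLoss_inter (hp : p < 1) (t v : ℕ) {B : Set Scenario}
    (hB : MeasurableSet B) :
    startLaw p v (firstLoss α β k t ∩ shift α β k (t + 1) ⁻¹' B)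
      = survival α k p v t * (1 - keep p ^ ((increase α k)^[t] v))
        * startLaw p (decrease β ((increase α k)^[t] v)) B := by
  induction t generalizing v with
  | zero =>
    rw [survival, one_mul, Function.iterate_zero_apply, ← startLaw_loss_inter (α := α) (k := k) hp v hB]
    congr 1
    ext ω
    simp [mem_firstLoss_zero]
  | succ t ih =>
    rw [survival, Function.iterate_succ_apply, mul_assoc, mul_assoc, ← mul_assoc (survival _ _ _ _ _),
      ← ih, ← startLaw_noLoss_inter (β := β) hp v
        ((measurableSet_firstLoss t).inter (measurable_shift α β k (t + 1) hB))]
    congr 1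
    ext ω
    simp only [Set.mem_inter_iff, Set.mem_preimage, mem_firstLoss_succ, Set.mem_ofPred_eq,
      shift_succ (t + 1) ω, and_assoc]

theorem survival_le (v : ℕ) (hv : 1 ≤ v) (t : ℕ) : survival α k p v t ≤ keep p ^ t := by
  induction t generalizing v with
  | zero => simp [survival]
  | succ t ih =>
    rw [survival, pow_succ']
    gcongr
    · exact pow_le_of_le_one zero_le (keep_le_one p) (by omega)
    · exact ih _ (by have := lt_increase (α := α) (k := k) v; omega)

theorem startLaw_forall_not_hasLoss (hp₀ : 0 < p) (hp : p < 1) {v : ℕ} (hv : 1 ≤ v) :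
    startLaw p v {ω | ∀ i, ¬ HasLoss α β k ω i} = 0 := by
  refine le_antisymm (ge_of_tendsto' (ENNReal.tendsto_pow_atTop_nhds_zero_of_lt_one (keep_lt_one hp₀))
    fun t => ?_) zero_le
  refine le_trans (measure_mono ?_) ((startLaw_forall_noLoss (α := α) (β := β) (k := k) hp t v).trans_le
    (survival_le v hv t))
  exact fun ω h i _ => h i

theorem startLaw_forall_ge_not_hasLoss (hp₀ : 0 < p) (hp : p < 1) (n : ℕ) {v : ℕ} (hv : 1 ≤ v) :
    startLaw p v {ω | ∀ i, n ≤ i → ¬ HasLoss α β k ω i} = 0 := by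
  induction n generalizing v with
  | zero => simpa using startLaw_forall_not_hasLoss hp₀ hp hv
  | succ n ih =>
    have hm : MeasurableSet {ω | ∀ i, n ≤ i → ¬ HasLoss α β k ω i} := by
      have : {ω | ∀ i, n ≤ i → ¬ HasLoss α β k ω i}
          = ⋂ i ∈ Set.Ici n, {ω | HasLoss α β k ω i}ᶜ := by
        ext ω; simp
      rw [this]
      exact MeasurableSet.biInter (Set.to_countable _) fun i _ =>
        (measurableSet_hasLoss α β k i).compl
    have hsub : {ω | ∀ i, n + 1 ≤ i → ¬ HasLoss α β k ω i} ⊆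
        ({ω | ¬ HasLoss α β k ω 0} ∩ shift α β k 1 ⁻¹' {ω | ∀ i, n ≤ i → ¬ HasLoss α β k ω i}) ∪
        ({ω | HasLoss α β k ω 0} ∩ shift α β k 1 ⁻¹' {ω | ∀ i, n ≤ i → ¬ HasLoss α β k ω i}) := by
      intro ω h
      have h' : ω ∈ shift α β k 1 ⁻¹' {ω | ∀ i, n ≤ i → ¬ HasLoss α β k ω i} := by
        intro i hi
        rw [hasLoss_shift]
        exact h _ (by omega)
      by_cases h0 : HasLoss α β k ω 0
      · exact Or.inr ⟨h0, h'⟩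
      · exact Or.inl ⟨h0, h'⟩
    refine measure_mono_null hsub (measure_union_null ?_ ?_)
    · rw [startLaw_noLoss_inter hp v hm,
        ih (by have := lt_increase (α := α) (k := k) v; omega), mul_zero]
    · rw [startLaw_loss_inter hp v hm, ih (one_le_decrease v), mul_zero]

theorem ae_startLaw_frequently_hasLoss (hp₀ : 0 < p) (hp : p < 1) {v : ℕ} (hv : 1 ≤ v) :
    ∀ᵐ ω ∂startLaw p v, ∀ n, ∃ m, n ≤ m ∧ HasLoss α β k ω m := by
  rw [ae_all_iff]
  intro n
  rw [ae_iff]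
  simpa only [not_exists, not_and] using startLaw_forall_ge_not_hasLoss hp₀ hp n hv

theorem ae_scenarioLaw_frequently_hasLoss (hp₀ : 0 < p) (hp : p < 1) {μ : Measure ℕ}
    (hμ : IsInitialLaw μ) :
    ∀ᵐ ω ∂scenarioLaw p μ, ∀ n, ∃ m, n ≤ m ∧ HasLoss α β k ω m := by
  have hm : MeasurableSet {ω | ∀ n, ∃ m, n ≤ m ∧ HasLoss α β k ω m} := by
    have : {ω | ∀ n, ∃ m, n ≤ m ∧ HasLoss α β k ω m}
        = ⋂ n, ⋃ m ∈ Set.Ici n, {ω | HasLoss α β k ω m} := by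
      ext ω; simp
    rw [this]
    exact MeasurableSet.iInter fun n => MeasurableSet.biUnion (Set.to_countable _) fun m _ =>
      measurableSet_hasLoss α β k m
  rw [ae_iff]
  change scenarioLaw p μ {ω | ∀ n, ∃ m, n ≤ m ∧ HasLoss α β k ω m}ᶜ = 0
  rw [scenarioLaw_apply _ hm.compl, lintegral_eq_zero_iff (measurable_of_countable _)]
  filter_upwards [hμ.ae_pos] with v hv
  exact ae_iff.1 (ae_startLaw_frequently_hasLoss hp₀ hp hv)

end Start

/-! ### The Markov chain of windows at loss epochs -/

section Kernel

variable {α β k : ℝ} {p : unitInterval}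

/-- The law of the window at the next loss epoch, starting from window `v`. -/
noncomputable def nextLossLaw (α β k : ℝ) (p : unitInterval) (v : ℕ) : Measure ℕ :=
  Measure.sum fun t => (survival α k p v t * (1 - keep p ^ ((increase α k)^[t] v))) •
    Measure.dirac (decrease β ((increase α k)^[t] v))

theorem lintegral_nextLossLaw (v : ℕ) (g : ℕ → ℝ≥0∞) :
    ∫⁻ y, g y ∂nextLossLaw α β k p v
      = ∑' t, survival α k p v t * (1 - keep p ^ ((increase α k)^[t] v))
        * g (decrease β ((increase α k)^[t] v)) := by
  rw [nextLossLaw, lintegral_sum_measure]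
  simp only [lintegral_smul_measure, lintegral_dirac, smul_eq_mul]

/-- The scenario seen from the first loss epoch on is a scenario started from the window at that
epoch. -/
theorem startLaw_lossShift (hp₀ : 0 < p) (hp : p < 1) {v : ℕ} (hv : 1 ≤ v) {B : Set Scenario}
    (hB : MeasurableSet B) :
    startLaw p v (lossShift α β k ⁻¹' B) = ∫⁻ y, startLaw p y B ∂nextLossLaw α β k p v := by
  have hae : (lossShift α β k ⁻¹' B : Set Scenario) =ᵐ[startLaw p v]
      (⋃ t, firstLoss α β k t ∩ shift α β k (t + 1) ⁻¹' B : Set Scenario) := by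
    filter_upwards [ae_startLaw_frequently_hasLoss (α := α) (β := β) (k := k) hp₀ hp hv] with ω hω
    obtain ⟨m, -, hm⟩ := hω 0
    obtain ⟨t, ht⟩ := exists_mem_firstLoss ⟨m, hm⟩
    have h1 : ∀ s, ω ∈ firstLoss α β k s → lossShift α β k ω = shift α β k (s + 1) ω :=
      fun s hs => by rw [lossShift, lossEpoch_one_of_mem_firstLoss hs]
    refine propext ⟨fun h => ?_, fun h => ?_⟩
    · exact Set.mem_iUnion.2 ⟨t, ht, by
        have h2 : lossShift α β k ω ∈ B := h
        rwa [h1 t ht] at h2⟩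
    · obtain ⟨s, hs, hs'⟩ := Set.mem_iUnion.1 h
      change lossShift α β k ω ∈ B
      rw [h1 s hs]
      exact hs'
  rw [measure_congr hae, measure_iUnion (fun s t hst => (pairwise_disjoint_firstLoss hst).mono
    Set.inter_subset_left Set.inter_subset_left)
    (fun t => (measurableSet_firstLoss t).inter (measurable_shift α β k (t + 1) hB)),
    lintegral_nextLossLaw]
  exact tsum_congr fun t => startLaw_firstLoss_inter hp t v hB

/-- The transition kernel of the windows at loss epochs. The state `0` is treated like `1`. -/
noncomputable def lossKernel (α β k : ℝ) (p : unitInterval) : Kernel ℕ ℕ where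
  toFun v := nextLossLaw α β k p (max v 1)
  measurable' := measurable_of_countable _

theorem lossKernel_apply (v : ℕ) :
    lossKernel α β k p v = nextLossLaw α β k p (max v 1) := rfl

theorem isMarkovKernel_lossKernel (hp₀ : 0 < p) (hp : p < 1) :
    IsMarkovKernel (lossKernel α β k p) := by
  refine ⟨fun v => ⟨?_⟩⟩
  have := startLaw_lossShift (α := α) (β := β) (k := k) hp₀ hp (le_max_right v 1)
    MeasurableSet.univ
  simpa [lossKernel_apply] using this.symm

/-- The bridge from scenarios to the chain: a time shift by one loss acts on initial laws as the
kernel. -/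
theorem map_lossShift (hp₀ : 0 < p) (hp : p < 1) {μ : Measure ℕ} (hμ : IsInitialLaw μ) :
    (scenarioLaw p μ).map (lossShift α β k) = scenarioLaw p (μ.bind (lossKernel α β k p)) := by
  ext B hB
  rw [Measure.map_apply (measurable_lossShift α β k) hB,
    scenarioLaw_apply _ (measurable_lossShift α β k hB), scenarioLaw_apply _ hB,
    Measure.lintegral_bind (Kernel.aemeasurable _) (measurable_of_countable _).aemeasurable]
  refine lintegral_congr_ae ?_
  filter_upwards [hμ.ae_pos] with v hv
  rw [startLaw_lossShift hp₀ hp hv hB, lossKernel_apply, max_eq_left hv]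

theorem isInitialLaw_bind (hp₀ : 0 < p) (hp : p < 1) (μ : Measure ℕ)
    [IsProbabilityMeasure μ] : IsInitialLaw (μ.bind (lossKernel α β k p)) := by
  have := isMarkovKernel_lossKernel (α := α) (β := β) (k := k) hp₀ hp
  refine ⟨inferInstance, ?_⟩
  rw [ae_iff, Measure.bind_apply .of_discrete (Kernel.aemeasurable _),
    lintegral_eq_zero_iff (measurable_of_countable _)]
  refine ae_of_all _ fun v => ?_
  change lossKernel α β k p v {a | ¬ 1 ≤ a} = 0
  rw [lossKernel_apply, nextLossLaw, Measure.sum_apply _ .of_discrete]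
  refine ENNReal.tsum_eq_zero.2 fun t => ?_
  rw [Measure.smul_apply, Measure.dirac_apply' _ .of_discrete, Set.indicator_of_notMem, smul_zero]
  exact not_not.2 (one_le_decrease _)

end Kernel

/-! ### Drift and accessibility of the chain -/

variable {α β k : ℝ} {p : unitInterval}

theorem increase_le (hα : 0 < α) (hk : k < 1) {w : ℕ} (hw : 1 ≤ w) :
    increase α k w ≤ (2 + ⌈α⌉₊) * w := by
  refine Nat.floor_le_of_le ?_
  have hw' : (1 : ℝ) ≤ w := by exact_mod_cast hw
  have h1 : (w : ℝ) ^ k ≤ w := by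
    simpa using Real.rpow_le_rpow_of_exponent_le hw' hk.le
  have h2 : 0 ≤ α * (w : ℝ) ^ k := by positivity
  have h3 : max (α * (w : ℝ) ^ k - 1) 0 ≤ α * (w : ℝ) ^ k := max_le (by linarith) h2
  have h4 : α * (w : ℝ) ^ k ≤ ⌈α⌉₊ * w := by
    gcongr
    exact Nat.le_ceil α
  push_cast
  linarith

theorem decrease_le_self (hβ₀ : 0 < β) {w : ℕ} (hw : 1 ≤ w) : decrease β w ≤ w := by
  refine max_le hw (Nat.floor_le_of_le ?_)
  have : (0 : ℝ) ≤ w := by positivity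
  nlinarith

theorem decrease_le_pred (hβ₀ : 0 < β) {w : ℕ} (hw : 1 ≤ w) : decrease β w ≤ max 1 (w - 1) := by
  refine max_le_max le_rfl (Nat.le_sub_one_of_lt ((Nat.floor_lt' (by omega)).2 ?_))
  have : (1 : ℝ) ≤ w := by exact_mod_cast hw
  nlinarith

/-- Only the last, smallest factor is kept. As the windows on the way are distinct, sums over `t`
are then dominated by sums over all `w` of terms with `keep p ^ w`, uniformly in `v`. -/
theorem survival_succ_le (v t : ℕ) :
    survival α k p v (t + 1) ≤ keep p ^ ((increase α k)^[t] v) := by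
  induction t generalizing v with
  | zero => simp [survival]
  | succ t ih =>
    rw [survival, Function.iterate_succ_apply]
    exact (mul_le_of_le_one_left zero_le (pow_le_one' (keep_le_one p) v)).trans (ih _)

theorem survival_le_one (v t : ℕ) : survival α k p v t ≤ 1 := by
  cases t with
  | zero => exact le_rfl
  | succ t => exact (survival_succ_le v t).trans (pow_le_one' (keep_le_one p) _)

theorem iterate_increase_strictMono (v : ℕ) : StrictMono fun t => (increase α k)^[t] v := by
  refine strictMono_nat_of_lt_succ fun t => ?_
  rw [Function.iterate_succ_apply']
  exact lt_increase _

theorem tsum_keep_pow_mul_rpow_ne_top (hp₀ : 0 < p) {η : ℝ} (hη : 0 < η) :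
    ∑' w : ℕ, keep p ^ w * (w : ℝ≥0∞) ^ η ≠ ∞ := by
  set r := (keep p).toReal with hr
  have hr1 : r < 1 := by
    have := (ENNReal.toReal_lt_toReal (keep_ne_top p) ENNReal.one_ne_top).2 (keep_lt_one hp₀)
    simpa using this
  have hs : Summable fun w : ℕ => (w : ℝ) ^ ⌈η⌉₊ * r ^ w :=
    summable_pow_mul_geometric_of_norm_lt_one _
      (by rwa [Real.norm_of_nonneg ENNReal.toReal_nonneg])
  refine ne_top_of_le_ne_top (hs.tsum_ofReal_ne_top) (ENNReal.tsum_le_tsum fun w => ?_)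
  rw [ENNReal.ofReal_mul (by positivity), ENNReal.ofReal_pow (by positivity),
    ENNReal.ofReal_pow ENNReal.toReal_nonneg, ENNReal.ofReal_toReal (keep_ne_top p),
    ENNReal.ofReal_natCast, mul_comm]
  gcongr
  rcases Nat.eq_zero_or_pos w with rfl | hw
  · rw [Nat.cast_zero, ENNReal.zero_rpow_of_pos hη]
    exact zero_le
  · rw [← ENNReal.rpow_natCast]
    exact ENNReal.rpow_le_rpow_of_exponent_le (by exact_mod_cast hw) (Nat.le_ceil η)

theorem decrease_rpow_le (hβ₁ : β < 1) {η : ℝ} (hη : 0 < η) (w : ℕ) :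
    (decrease β w : ℝ≥0∞) ^ η ≤ ENNReal.ofReal (1 - β) ^ η * (w : ℝ≥0∞) ^ η + 1 := by
  have h : (decrease β w : ℝ≥0∞) ≤ max 1 (ENNReal.ofReal (1 - β) * w) := by
    rw [decrease, (Nat.mono_cast (α := ℝ≥0∞)).map_max, Nat.cast_one]
    refine max_le_max le_rfl ?_
    rw [← ENNReal.ofReal_natCast w, ← ENNReal.ofReal_mul (by linarith), ← ENNReal.ofReal_natCast]
    exact ENNReal.ofReal_le_ofReal (Nat.floor_le (mul_nonneg (by linarith) (by positivity)))
  refine (ENNReal.rpow_le_rpow h hη.le).trans ?_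
  rcases max_cases (1 : ℝ≥0∞) (ENNReal.ofReal (1 - β) * w) with ⟨h1, -⟩ | ⟨h1, -⟩
  · rw [h1, ENNReal.one_rpow]
    exact le_add_self
  · rw [h1, ENNReal.mul_rpow_of_nonneg _ _ hη.le]
    exact le_self_add

/-- Geometric drift of the powers of the window at loss epochs. -/
theorem exists_drift (hα : 0 < α) (hβ₀ : 0 < β) (hβ₁ : β < 1) (hk : k < 1) (hp₀ : 0 < p)
    {η : ℝ} (hη : 0 < η) : ∃ γ K : ℝ≥0, γ < 1 ∧ ∀ x : ℕ,
      ∫⁻ y, (y : ℝ≥0∞) ^ η ∂lossKernel α β k p x ≤ γ * (x : ℝ≥0∞) ^ η + K := by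
  set G : ℝ≥0∞ := ∑' w : ℕ, keep p ^ w * (w : ℝ≥0∞) ^ η with hG
  set A : ℕ := 2 + ⌈α⌉₊
  set γ : ℝ≥0 := (1 - β).toNNReal ^ η with hγ
  have hγ' : (γ : ℝ≥0∞) = ENNReal.ofReal (1 - β) ^ η := by
    rw [hγ, ENNReal.coe_rpow_of_nonneg _ hη.le]; rfl
  have hGtop : (A : ℝ≥0∞) ^ η * G ≠ ∞ :=
    ENNReal.mul_ne_top (ENNReal.rpow_ne_top_of_nonneg hη.le (ENNReal.natCast_ne_top _))
      (tsum_keep_pow_mul_rpow_ne_top hp₀ hη)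
  have main : ∀ v : ℕ, 1 ≤ v → ∫⁻ y, (y : ℝ≥0∞) ^ η ∂nextLossLaw α β k p v
      ≤ γ * (v : ℝ≥0∞) ^ η + (1 + (A : ℝ≥0∞) ^ η * G) := by
    intro v hv
    have hv' : ∀ t, 1 ≤ (increase α k)^[t] v := fun t =>
      hv.trans ((iterate_increase_strictMono v).monotone (Nat.zero_le t))
    -- The term `t = 0`, an immediate loss, yields the contraction; all others go into the constant.
    rw [lintegral_nextLossLaw, tsum_eq_zero_add' ENNReal.summable, ← add_assoc]
    refine add_le_add ?_ ?_
    · rw [hγ']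
      refine le_trans ?_ (decrease_rpow_le hβ₁ hη v)
      exact mul_le_of_le_one_left zero_le (mul_le_one' (survival_le_one v 0) tsub_le_self)
    · calc ∑' t, survival α k p v (t + 1) * (1 - keep p ^ ((increase α k)^[t + 1] v))
            * (decrease β ((increase α k)^[t + 1] v) : ℝ≥0∞) ^ η
          ≤ ∑' t, (A : ℝ≥0∞) ^ η * (keep p ^ ((increase α k)^[t] v)
            * (((increase α k)^[t] v : ℕ) : ℝ≥0∞) ^ η) := by
            refine ENNReal.tsum_le_tsum fun t => ?_
            have h1 : (decrease β ((increase α k)^[t + 1] v) : ℝ≥0∞)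
                ≤ A * ((increase α k)^[t] v : ℕ) := by
              have := (decrease_le_self hβ₀ (hv' (t + 1))).trans_eq
                (Function.iterate_succ_apply' (increase α k) t v)
              exact_mod_cast this.trans (increase_le hα hk (hv' t))
            calc _ ≤ keep p ^ ((increase α k)^[t] v) * 1
                  * (A * ((increase α k)^[t] v : ℕ) : ℝ≥0∞) ^ η := by
                  gcongr
                  · exact survival_succ_le v t
                  · exact tsub_le_self
              _ = _ := by rw [ENNReal.mul_rpow_of_nonneg _ _ hη.le]; ring
        _ = (A : ℝ≥0∞) ^ η * ∑' t, (keep p ^ ((increase α k)^[t] v)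
            * (((increase α k)^[t] v : ℕ) : ℝ≥0∞) ^ η) := ENNReal.tsum_mul_left
        _ ≤ (A : ℝ≥0∞) ^ η * G := by
            gcongr
            exact ENNReal.tsum_comp_le_tsum_of_injective
              (iterate_increase_strictMono (α := α) (k := k) v).injective
              fun w : ℕ => keep p ^ w * (w : ℝ≥0∞) ^ η
  -- The extra `γ` covers the state `0`, which the kernel treats as `1`.
  refine ⟨γ, γ + (1 + ((A : ℝ≥0∞) ^ η * G).toNNReal), ?_, fun x => ?_⟩
  · refine NNReal.rpow_lt_one ?_ hη
    rw [Real.toNNReal_lt_one]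
    linarith
  · rw [lossKernel_apply]
    refine (main _ (le_max_right x 1)).trans ?_
    push_cast
    rw [ENNReal.coe_toNNReal hGtop, ← add_assoc (_ * _) (γ : ℝ≥0∞)]
    refine add_le_add_left ?_ _
    rcases Nat.eq_zero_or_pos x with rfl | hx
    · simp
    · rw [max_eq_left hx]
      exact le_self_add

theorem le_lossKernel_singleton (x : ℕ) :
    1 - keep p ≤ lossKernel α β k p x {decrease β (max x 1)} := by
  rw [lossKernel_apply, nextLossLaw]
  refine le_trans ?_ (Measure.le_sum_apply _ _)
  refine le_trans ?_ (ENNReal.le_tsum 0)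
  simp only [survival, Function.iterate_zero_apply, one_mul, Measure.smul_apply, smul_eq_mul,
    Measure.dirac_apply_of_mem (Set.mem_singleton _), mul_one]
  exact tsub_le_tsub_left (pow_le_of_le_one zero_le (keep_le_one p) (by omega)) 1

/-- Each immediate loss lowers a window above `1` by at least one, and a window at `1` stays there.
One step is needed even from `0`, hence `1 ≤ n`. -/
theorem le_lossKernel_pow_one (hβ₀ : 0 < β) (n x : ℕ) (hn : 1 ≤ n) (hx : x ≤ n) :
    (1 - keep p) ^ n ≤ (lossKernel α β k p ^ n) x {1} := by
  induction n, hn using Nat.le_induction generalizing x with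
  | base =>
    have := decrease_le_pred hβ₀ (le_max_right x 1)
    have h1 : decrease β (max x 1) = 1 :=
      le_antisymm (this.trans (by omega)) (one_le_decrease _)
    simpa [h1] using le_lossKernel_singleton (α := α) (β := β) (k := k) (p := p) x
  | succ n hn ih =>
    have hd : decrease β (max x 1) ≤ n :=
      (decrease_le_pred hβ₀ (le_max_right x 1)).trans (by omega)
    rw [pow_succ, pow_succ, ← lintegral_indicator_one (.of_discrete), MarkovChain.lintegral_mul]
    calc (1 - keep p) ^ n * (1 - keep p)
        ≤ (lossKernel α β k p ^ n) (decrease β (max x 1)) {1}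
          * lossKernel α β k p x {decrease β (max x 1)} :=
          mul_le_mul' (ih _ hd) (le_lossKernel_singleton x)
      _ = ∫⁻ y in {decrease β (max x 1)}, (lossKernel α β k p ^ n) y {1}
            ∂lossKernel α β k p x := by rw [lintegral_singleton]
      _ ≤ ∫⁻ y, (lossKernel α β k p ^ n) y {1} ∂lossKernel α β k p x :=
          setLIntegral_le_lintegral _ _
      _ = _ := by simp_rw [lintegral_indicator_one (MeasurableSet.of_discrete (s := ({1} : Set ℕ)))]

end TCPCompound

/-! ### Fatou's lemma for limits of measures -/

namespace MarkovChain

open Filter Topology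
open scoped ENNReal NNReal

/-- The masses of points converge, so the bound passes to finite partial sums and then to their
supremum. -/
theorem lintegral_le_of_tendsto {m : ℕ → Measure ℕ} [∀ n, IsProbabilityMeasure (m n)]
    {π : Measure ℕ} [IsProbabilityMeasure π] (h : ∀ φ : ℕ → ℝ, (∀ x, |φ x| ≤ 1) →
      Tendsto (fun n => ∫ x, φ x ∂m n) atTop (𝓝 (∫ x, φ x ∂π)))
    {g : ℕ → ℝ≥0∞} (hg : ∀ x, g x ≠ ∞) {C : ℝ≥0∞} (hC : ∀ n, ∫⁻ x, g x ∂m n ≤ C) :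
    ∫⁻ x, g x ∂π ≤ C := by
  have hs : ∀ x : ℕ, Tendsto (fun n => m n {x}) atTop (𝓝 (π {x})) := by
    intro x
    rw [← ENNReal.tendsto_toReal_iff (fun n => measure_ne_top _ _) (measure_ne_top _ _)]
    have := h (({x} : Set ℕ).indicator 1) fun y => by
      by_cases hy : y ∈ ({x} : Set ℕ)
      · rw [Set.indicator_of_mem hy]; simp
      · rw [Set.indicator_of_notMem hy]; simp
    simp only [integral_indicator_one (MeasurableSet.of_discrete (s := ({x} : Set ℕ)))] at this
    exact this
  rw [lintegral_countable', ENNReal.tsum_eq_iSup_sum]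
  refine iSup_le fun s => le_of_tendsto'
    (tendsto_finsetSum s fun x _ => ENNReal.Tendsto.const_mul (hs x) (Or.inr (hg x))) fun n => ?_
  refine le_trans ?_ (hC n)
  rw [lintegral_countable']
  exact ENNReal.sum_le_tsum s

end MarkovChain

/-! ### Stationary versions and moments -/

namespace TCPCompound

open Filter Topology
open scoped ENNReal NNReal

variable {α β k : ℝ} {p : unitInterval}

/-- A process whose shift is the same process in the scenario seen from the first loss epoch. -/
structure IsLossProcess (α β k : ℝ) (X : ℕ → Scenario → ℕ) : Prop where
  measurable : ∀ j, Measurable (X j)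
  succ : ∀ ω : Scenario, (∀ n, ∃ m, n ≤ m ∧ HasLoss α β k ω m) →
    ∀ j, X (j + 1) ω = X j (lossShift α β k ω)

theorem isLossProcess_lossWindow : IsLossProcess α β k (lossWindow α β k) :=
  ⟨measurable_lossWindow α β k, fun _ hω j => lossWindow_succ hω j⟩

theorem isLossProcess_interLossTime : IsLossProcess α β k (interLossTime α β k) :=
  ⟨measurable_interLossTime α β k, fun _ hω j => interLossTime_succ hω j⟩

theorem measurable_seqShift : Measurable fun (x : ℕ → ℕ) (j : ℕ) => x (j + 1) :=
  measurable_pi_lambda _ fun j => measurable_pi_apply (j + 1)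

theorem IsLossProcess.map_shift {X : ℕ → Scenario → ℕ} (hX : IsLossProcess α β k X) (hp₀ : 0 < p)
    (hp : p < 1) {μ : Measure ℕ} (hμ : IsInitialLaw μ) :
    ((scenarioLaw p μ).map fun ω j => X j ω).map (fun x j => x (j + 1))
      = (scenarioLaw p (μ.bind (lossKernel α β k p))).map fun ω j => X j ω := by
  have hm : Measurable fun (ω : Scenario) (j : ℕ) => X j ω := measurable_pi_lambda _ hX.measurable
  rw [Measure.map_map measurable_seqShift hm, ← map_lossShift hp₀ hp hμ,
    Measure.map_map hm (measurable_lossShift α β k)]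
  refine Measure.map_congr ?_
  filter_upwards [ae_scenarioLaw_frequently_hasLoss (α := α) (β := β) (k := k) hp₀ hp hμ] with ω hω
  funext j
  exact hX.succ ω hω j

theorem map_lossWindow_zero (μ : Measure ℕ) [IsProbabilityMeasure μ] :
    (scenarioLaw p μ).map (lossWindow α β k 0) = μ := by
  change (μ.prod _).map Prod.fst = μ
  simp

theorem map_lossWindow_one (hp₀ : 0 < p) (hp : p < 1) {μ : Measure ℕ} (hμ : IsInitialLaw μ) :
    (scenarioLaw p μ).map (lossWindow α β k 1) = μ.bind (lossKernel α β k p) := by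
  have := isMarkovKernel_lossKernel (α := α) (β := β) (k := k) hp₀ hp
  have := hμ.isProbabilityMeasure
  have hX := isLossProcess_lossWindow (α := α) (β := β) (k := k)
  have hm : Measurable fun (ω : Scenario) (j : ℕ) => lossWindow α β k j ω :=
    measurable_pi_lambda _ hX.measurable
  have h := congrArg (Measure.map fun x : ℕ → ℕ => x 0) (hX.map_shift hp₀ hp hμ)
  rw [Measure.map_map (measurable_pi_apply 0) measurable_seqShift,
    Measure.map_map ((measurable_pi_apply 0).comp measurable_seqShift) hm,
    Measure.map_map (measurable_pi_apply 0) hm] at h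
  exact h.trans (map_lossWindow_zero _)

theorem IsLossProcess.isStationaryLaw {X : ℕ → Scenario → ℕ} (hX : IsLossProcess α β k X)
    (hp₀ : 0 < p) (hp : p < 1) {μ : Measure ℕ} (hμ : IsInitialLaw μ)
    (hinv : μ.bind (lossKernel α β k p) = μ) :
    IsStationaryLaw p X ((scenarioLaw p μ).map fun ω j => X j ω) :=
  ⟨μ, hμ, rfl, by rw [hX.map_shift hp₀ hp hμ, hinv]⟩

/-- The time-zero marginal of the window process is the initial law itself, so shift invariance of
the process law forces invariance under the kernel. -/
theorem isStationaryDistribution_lossWindow_iff (hp₀ : 0 < p) (hp : p < 1) {π : Measure ℕ} :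
    IsStationaryDistribution p (lossWindow α β k) π ↔
      IsInitialLaw π ∧ π.bind (lossKernel α β k p) = π := by
  have hX := isLossProcess_lossWindow (α := α) (β := β) (k := k)
  have hm : Measurable fun (ω : Scenario) (j : ℕ) => lossWindow α β k j ω :=
    measurable_pi_lambda _ hX.measurable
  have h0 : ∀ (μ : Measure ℕ) [IsProbabilityMeasure μ],
      ((scenarioLaw p μ).map fun ω j => lossWindow α β k j ω).map (fun x : ℕ → ℕ => x 0) = μ := by
    intro μ _
    rw [Measure.map_map (measurable_pi_apply 0) hm]
    exact map_lossWindow_zero μ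
  constructor
  · rintro ⟨Q, ⟨μ, hμ, rfl, hQ⟩, hπ⟩
    have := hμ.isProbabilityMeasure
    have := isMarkovKernel_lossKernel (α := α) (β := β) (k := k) hp₀ hp
    rw [h0 μ] at hπ
    subst hπ
    refine ⟨hμ, ?_⟩
    rw [hX.map_shift hp₀ hp hμ] at hQ
    rw [← h0 (μ.bind (lossKernel α β k p)), hQ, h0]
  · rintro ⟨hπ, hinv⟩
    have := hπ.isProbabilityMeasure
    exact ⟨_, hX.isStationaryLaw hp₀ hp hπ hinv, h0 π⟩

/-- The process of a stationary version looks the same when it is started with the law of the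
window at any later loss epoch. -/
theorem IsLossProcess.map_bind_pow {X : ℕ → Scenario → ℕ} (hX : IsLossProcess α β k X)
    (hp₀ : 0 < p) (hp : p < 1) {μ : Measure ℕ} (hμ : IsInitialLaw μ)
    (hQ : ((scenarioLaw p μ).map fun ω j => X j ω).map (fun x j => x (j + 1))
      = (scenarioLaw p μ).map fun ω j => X j ω) (n : ℕ) :
    IsInitialLaw (μ.bind (lossKernel α β k p ^ n : Kernel ℕ ℕ)) ∧
    (scenarioLaw p (μ.bind (lossKernel α β k p ^ n : Kernel ℕ ℕ))).map (fun ω j => X j ω)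
      = (scenarioLaw p μ).map fun ω j => X j ω := by
  induction n with
  | zero => rw [pow_zero, MarkovChain.bind_one]; exact ⟨hμ, rfl⟩
  | succ n ih =>
    have := ih.1.isProbabilityMeasure
    rw [pow_succ', MarkovChain.bind_mul]
    refine ⟨isInitialLaw_bind hp₀ hp _, ?_⟩
    rw [← hX.map_shift hp₀ hp ih.1, ih.2, hQ]

theorem scenarioLaw_toReal_eq_integral (μ : Measure ℕ) {B : Set Scenario} (hB : MeasurableSet B) :
    (scenarioLaw p μ B).toReal = ∫ v, (startLaw p v B).toReal ∂μ := by
  rw [scenarioLaw_apply _ hB, integral_toReal (measurable_of_countable _).aemeasurable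
    (ae_of_all _ fun v => measure_lt_top _ _)]

theorem lossKernel_exists_invariant_and_tendsto (hα : 0 < α) (hβ₀ : 0 < β) (hβ₁ : β < 1)
    (hk : k < 1) (hp₀ : 0 < p) (hp : p < 1) :
    ∃ (N : ℕ) (π : Measure ℕ), IsProbabilityMeasure π ∧ π.bind (lossKernel α β k p) = π ∧
      ∀ (μ : Measure ℕ) [IsProbabilityMeasure μ] (φ : ℕ → ℝ), (∀ x, |φ x| ≤ 1) →
        Tendsto (fun m : ℕ => ∫ x, φ x ∂(μ.bind (lossKernel α β k p ^ (N * m) : Kernel ℕ ℕ)))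
          atTop (𝓝 (∫ x, φ x ∂π)) := by
  have := isMarkovKernel_lossKernel (α := α) (β := β) (k := k) hp₀ hp
  obtain ⟨γ, K, hγ, drift⟩ := exists_drift (p := p) hα hβ₀ hβ₁ hk hp₀ one_pos
  simp only [ENNReal.rpow_one] at drift
  have htop : 1 - keep p ≠ ∞ := ne_top_of_le_ne_top ENNReal.one_ne_top tsub_le_self
  refine MarkovChain.exists_invariant_and_tendsto (lossKernel α β k p) hγ drift
    (c := (1 - keep p).toNNReal) ?_ fun n x hn hx => ?_
  · exact ENNReal.toNNReal_pos (tsub_pos_of_lt (keep_lt_one hp₀)).ne' htop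
  · rw [ENNReal.coe_toNNReal htop]
    exact le_lossKernel_pow_one hβ₀ n x hn hx

theorem bind_pow_of_bind {κ : Kernel ℕ ℕ} {μ : Measure ℕ} (h : μ.bind κ = μ) (n : ℕ) :
    μ.bind (κ ^ n : Kernel ℕ ℕ) = μ := by
  induction n with
  | zero => rw [pow_zero, MarkovChain.bind_one]
  | succ n ih => rw [pow_succ, MarkovChain.bind_mul, h, ih]

theorem lintegral_rpow_lt_top (hα : 0 < α) (hβ₀ : 0 < β) (hβ₁ : β < 1) (hk : k < 1) (hp₀ : 0 < p)
    (hp : p < 1) {N : ℕ} {π : Measure ℕ} [IsProbabilityMeasure π]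
    (hlim : ∀ (μ : Measure ℕ) [IsProbabilityMeasure μ] (φ : ℕ → ℝ), (∀ x, |φ x| ≤ 1) →
        Tendsto (fun m : ℕ => ∫ x, φ x ∂(μ.bind (lossKernel α β k p ^ (N * m) : Kernel ℕ ℕ)))
          atTop (𝓝 (∫ x, φ x ∂π))) {η : ℝ} (hη : 0 < η) :
    ∫⁻ x, (x : ℝ≥0∞) ^ η ∂π < ∞ := by
  have := isMarkovKernel_lossKernel (α := α) (β := β) (k := k) hp₀ hp
  have hpow := MarkovChain.isMarkovKernel_pow (lossKernel α β k p)
  obtain ⟨γ, K, hγ, drift⟩ := exists_drift (p := p) hα hβ₀ hβ₁ hk hp₀ hη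
  have h1γ : (1 - γ : ℝ≥0) ≠ 0 := (tsub_pos_of_lt hγ).ne'
  have hKK : γ * (K / (1 - γ)) + K ≤ K / (1 - γ) := by
    have : K / (1 - γ) * (1 - γ) = K := div_mul_cancel₀ _ h1γ
    rw [← NNReal.coe_inj] at this
    rw [← NNReal.coe_le_coe]
    push_cast [NNReal.coe_sub hγ.le] at this ⊢
    linarith
  have hbound : ∀ n : ℕ, ∫⁻ x, (x : ℝ≥0∞) ^ η
      ∂((Measure.dirac 1).bind (lossKernel α β k p ^ n : Kernel ℕ ℕ)) ≤ 1 + (K / (1 - γ) : ℝ≥0) := by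
    intro n
    rw [Measure.dirac_bind (Kernel.measurable _)]
    cases n with
    | zero =>
      rw [pow_zero, MarkovChain.lintegral_one]
      simp
    | succ n =>
      refine (MarkovChain.lintegral_pow_le hγ.le hKK drift n 1).trans ?_
      gcongr
      simpa using hγ.le
  -- The moment bound holds at all times for the chain started at `1`, so no moment of `π` has to be
  -- assumed finite beforehand.
  exact (MarkovChain.lintegral_le_of_tendsto (hlim (Measure.dirac 1))
    (fun x => ENNReal.rpow_ne_top_of_nonneg hη.le (ENNReal.natCast_ne_top x))
    fun m => hbound (N * m)).trans_lt
      (ENNReal.add_lt_top.2 ⟨ENNReal.one_lt_top, ENNReal.coe_lt_top⟩)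

end TCPCompound

theorem mainTheorem8 (α β k : ℝ) (hα : 0 < α) (hβ₀ : 0 < β) (hβ₁ : β < 1)
    (hk₀ : 0 < k) (hk₁ : k < 1) (p : unitInterval) (hp₀ : 0 < p) (hp₁ : p < 1) :
    -- the process of windows at loss epochs has a unique stationary distribution
    (∃! π : Measure ℕ,
      TCPCompound.IsStationaryDistribution p (TCPCompound.lossWindow α β k) π) ∧
    -- in particular any law that is preserved by one step of this process is that distribution
    (∀ μ : Measure ℕ, TCPCompound.IsInitialLaw μ →
      (TCPCompound.scenarioLaw p μ).map (TCPCompound.lossWindow α β k 1) = μ →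
      TCPCompound.IsStationaryDistribution p (TCPCompound.lossWindow α β k) μ) ∧
    -- the process of inter-loss times has a unique stationary distribution
    (∃! ν : Measure ℕ,
      TCPCompound.IsStationaryDistribution p (TCPCompound.interLossTime α β k) ν) ∧
    -- and all its stationary versions have the same law as processes
    (∃! Q : Measure (ℕ → ℕ),
      TCPCompound.IsStationaryLaw p (TCPCompound.interLossTime α β k) Q) ∧
    -- all moments of the window at loss epochs are finite under stationarity
    (∀ π : Measure ℕ,
      TCPCompound.IsStationaryDistribution p (TCPCompound.lossWindow α β k) π →
      ∀ η : ℝ, 1 ≤ η → Integrable (fun v : ℕ => (v : ℝ) ^ η) π) := by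
  open TCPCompound in
  obtain ⟨N, π, hπ, hinv, hlim⟩ :=
    lossKernel_exists_invariant_and_tendsto hα hβ₀ hβ₁ hk₁ hp₀ hp₁
  have hπ' : IsInitialLaw π := by
    have := isInitialLaw_bind (α := α) (β := β) (k := k) hp₀ hp₁ π
    rwa [hinv] at this
  have huniq : ∀ ρ : Measure ℕ, IsStationaryDistribution p (lossWindow α β k) ρ → ρ = π := by
    intro ρ hρ
    obtain ⟨hρ₀, hρ₁⟩ := (isStationaryDistribution_lossWindow_iff hp₀ hp₁).1 hρ
    have := hρ₀.isProbabilityMeasure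
    refine MarkovChain.measure_eq_of_integral_eq fun φ hφ => ?_
    have h := hlim ρ φ hφ
    simp_rw [bind_pow_of_bind hρ₁] at h
    exact tendsto_nhds_unique tendsto_const_nhds h
  have hG := isLossProcess_interLossTime (α := α) (β := β) (k := k)
  have hm : Measurable fun (ω : Scenario) (j : ℕ) => interLossTime α β k j ω :=
    measurable_pi_lambda _ hG.measurable
  have hGlaw : ∀ Q : Measure (ℕ → ℕ), IsStationaryLaw p (interLossTime α β k) Q →
      Q = (scenarioLaw p π).map fun ω j => interLossTime α β k j ω := by
    rintro Q ⟨μ, hμ, rfl, hQ⟩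
    have := hμ.isProbabilityMeasure
    ext B hB
    rw [← ENNReal.toReal_eq_toReal_iff' (by
      rw [Measure.map_apply hm hB]; exact measure_ne_top _ _) (by
      rw [Measure.map_apply hm hB]; exact measure_ne_top _ _)]
    -- Ergodicity is applied to the probability of `B` as a function of the initial window. By
    -- stationarity its averages along the chain from `μ` are constantly `Q B`, although `μ` itself
    -- is not known to be invariant.
    have h := hlim μ (fun v => (startLaw p v
      ((fun ω j => interLossTime α β k j ω) ⁻¹' B)).toReal) fun v => by
        rw [abs_of_nonneg ENNReal.toReal_nonneg]
        exact ENNReal.toReal_le_of_le_ofReal zero_le_one (by simpa using prob_le_one)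
    simp_rw [← scenarioLaw_toReal_eq_integral _ (hm hB), ← Measure.map_apply hm hB,
      (hG.map_bind_pow hp₀ hp₁ hμ hQ _).2] at h
    exact tendsto_nhds_unique tendsto_const_nhds h
  have hGstat := hG.isStationaryLaw hp₀ hp₁ hπ' hinv
  refine ⟨⟨π, (isStationaryDistribution_lossWindow_iff hp₀ hp₁).2 ⟨hπ', hinv⟩, huniq⟩,
    fun μ hμ h => ?_, ⟨_, ⟨_, hGstat, rfl⟩, ?_⟩, ⟨_, hGstat, hGlaw⟩, fun ρ hρ η hη => ?_⟩
  · rw [map_lossWindow_one hp₀ hp₁ hμ] at h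
    exact (isStationaryDistribution_lossWindow_iff hp₀ hp₁).2 ⟨hμ, h⟩
  · rintro ν ⟨Q, hQ, rfl⟩
    rw [hGlaw Q hQ]
  · rw [huniq ρ hρ]
    have hη' : 0 < η := one_pos.trans_le hη
    refine ⟨(measurable_of_countable _).aestronglyMeasurable, ?_⟩
    rw [hasFiniteIntegral_iff_ofReal (ae_of_all _ fun v => by positivity)]
    convert lintegral_rpow_lt_top hα hβ₀ hβ₁ hk₁ hp₀ hp₁ hlim hη' using 3 with v
    rw [← ENNReal.ofReal_rpow_of_nonneg (by positivity) hη'.le, ENNReal.ofReal_natCast]
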